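/- Throughout, $\log$ is the logarithm to base $2$, $m\ge 2$, and datasets are finite multisets $X$ of reals with sorted elements $x_{(1)}\le\dots\le x_{(n)}$, $n=|X|$ (and $x_{(k)}=0$ for $k\le 0$, $x_{(k)}=b$ for $k>n$); $\mathrm{rank}_X(z)=|\{x\in X:x<z\}|$. For real $h$ let $\mathsf{Good}_{m,n,h}$ be the set of $r\in\mathbb Z^m$ with $h\le r_1$, $r_{i-1}+2h\le r_i$ for $2\le i\le m$, and $r_m\le n-h$. **Algorithm.** $\mathsf{SliceQuantiles}$ has parameters $b,\varepsilon_1,\varepsilon_2,\ell,w>0$ and a permutation $\pi$ of $\{1,\dots,m\}$. Its input is a dataset $X$ in $[0,b]$ and a vector $r\in\mathbb Z^m$ of ranks, with the requirement $r\in\mathsf{Good}_{m,n,w+h+1}$, where $h=\lceil \ell/2\rceil$. (1) *Continual counting.* Let $T=\lceil\log(m+1)\rceil$. Put independent $\mathrm{Lap}(T/\varepsilon_1)$ noise on the nodes of the binary tree of dyadic intervals with $T$ levels; $\tilde r_i$ is $r_i$ plus the sum of the noises of the dyadic decomposition of $[0,i)$, rounded to the nearest integer (ties upwards). (2) If $\tilde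 r\notin\mathsf{Good}_{m,n,h}$, return $m$ independent uniform points of $(0,b)$ (the additional random failure coin of the algorithm has heads probability $\gamma=0$). (3) Otherwise, for $j=\pi(1),\dots,\pi(m)$ in this order: let $S_j=(x_{(\tilde r_j-h)},\dots,x_{(\tilde r_j+h)})$, let $a_j$ be the largest of $0$ and the $z_i$ already released with $i<j$, and $b_j$ the smallest of $b$ and the $z_i$ already released with $i>j$; draw $z_j\in(a_j,b_j)$ by the exponential mechanism, with density proportional to $\exp\!\big(-\tfrac{\varepsilon_2}{2}\,\big|\,|\{x\in S_j:x<z\}|-\lfloor |S_j|/2\rfloor\,\big|\big)$. Return $Z=(z_1,\dots,z_m)$. **Theorem.** Let $\varepsilon_1,\varepsilon_2,\delta>0$, $\varepsilon=\varepsilon_1+2\varepsilon_2$ and $w=3\log(m)\log(2m/\delta)/\varepsilon_1$. (a) *Privacy.* For all $b>0$, $\ell>0$, $\pi$ and $r$, $\mathsf{SliceQuantiles}$ is $(\varepsilon,\delta)$-differentially private under add/remove adjacency, on the datasets in $[0,b]$ that meet the requirement. (b) *Error.* For every $c>0$ there is a constant $C$, depending only on $c$, such that the following holds for all $m\geq 2$,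 $b>1$, $\pi$, $\varepsilon_1,\varepsilon_2\ge c\,\varepsilon$, $0<\delta\le\beta<1$ and $\ell=4\log(bm/\beta)/\varepsilon_2$. Let $X\subset(0,b)$ be a dataset of $n$ points with pairwise distances at least $1$, and $0\le q_1<\dots<q_m\le 1$ quantiles whose ranks $r_i=\lfloor q_in\rfloor$ meet the requirement. Then with probability at least $1-3\beta$ the output on $X$ and $r$ satisfies $$\mathrm{Err}_X(Q,Z)=\max_i|\mathrm{rank}_X(z_i)-\lfloor q_in\rfloor|\le C\Big(\frac{\log b}{\varepsilon}+\frac{\log(m)\log(m/\beta)}{\varepsilon}+1\Big).$$ (c) *Gap.* With the parameters of (b), for every $n\ge1$, the ranks $\lfloor q_in\rfloor$ meet the requirement whenever $\Delta'\le q_1$, $q_{i-1}+2\Delta'\le q_i$ for $2\le i\le m$, and $q_m\le 1-\Delta'$, where $\Delta'=\Delta+\frac3n$ and $$\Delta=\frac{3\log(m)\log(2m/\delta)}{\varepsilon_1 n}+\frac{2\log(bm/\beta)}{\varepsilon_2 n}.$$ So (b) applies to all quantiles with this gap. -/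

import Mathlib

open MeasureTheory Set
open scoped ENNReal

noncomputable section

namespace SliceQuantiles

/-! ### Datasets, ranks, rank error -/

/-- A dataset is a finite multiset of reals; `n` is its cardinality. -/
abbrev Dataset := Multiset ℝ

/-- The number of points of `X` strictly below `z`. -/
def rank (X : Dataset) (z : ℝ) : ℕ := (X.filter (fun x => x < z)).card

/-- The `k`-th smallest element `x_(k)` of `X` (`k = 1, …, n`), with the boundary convention
`x_(k) = 0` for `k ≤ 0` and `x_(k) = b` for `k > n`. -/
def orderStat (X : Dataset) (b : ℝ) (k : ℤ) : ℝ :=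
  if k ≤ 0 then 0 else (X.sort (· ≤ ·)).getD (k.toNat - 1) b

/-- The dataset has minimum gap at least `1`. -/
def HasUnitGap (X : Dataset) : Prop := X.Pairwise (fun x y => 1 ≤ |x - y|)

/-- The rank `⌊q n⌋` belonging to the quantile `q`. -/
def targetRank {m : ℕ} (q : Fin m → ℝ) (n : ℕ) : Fin m → ℤ := fun i => ⌊q i * n⌋

/-- `Err_X(Q, Z) = max_i |rank_X(z_i) - ⌊q_i n⌋|`. -/
def rankError {m : ℕ} (X : Dataset) (q z : Fin m → ℝ) : ℝ :=
  ⨆ i : Fin m, |(rank X (z i) : ℝ) - (targetRank q X.card i : ℝ)|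

/-- Quantiles `0 ≤ q_1 < … < q_m ≤ 1`. -/
def IsQuantiles {m : ℕ} (q : Fin m → ℝ) : Prop :=
  StrictMono q ∧ ∀ i, q i ∈ Icc (0 : ℝ) 1

/-- `Δ ≤ q_1`, `q_{i-1} + 2Δ ≤ q_i` and `q_m ≤ 1 - Δ`. -/
def HasQuantileGap {m : ℕ} (q : Fin m → ℝ) (Δ : ℝ) : Prop :=
  (∀ i : Fin m, i.val = 0 → Δ ≤ q i) ∧
  (∀ i j : Fin m, i.val + 1 = j.val → q i + 2 * Δ ≤ q j) ∧
  (∀ i : Fin m, i.val + 1 = m → q i ≤ 1 - Δ)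

/-- The set `Good_{m,n,h}` of rank vectors: `h ≤ r_1`, `r_{i-1} + 2h ≤ r_i`, `r_m ≤ n - h`. -/
def Good (m n : ℕ) (h : ℝ) : Set (Fin m → ℤ) :=
  {r | (∀ i : Fin m, i.val = 0 → h ≤ r i) ∧
    (∀ i j : Fin m, i.val + 1 = j.val → (r i : ℝ) + 2 * h ≤ r j) ∧
    (∀ i : Fin m, i.val + 1 = m → (r i : ℝ) ≤ n - h)}

/-! ### Differential privacy -/

/-- Add/remove adjacency. -/
def Adjacent (X X' : Dataset) : Prop := ∃ x : ℝ, X' = x ::ₘ X ∨ X = x ::ₘ X'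

/-- `(ε, δ)`-differential privacy under add/remove adjacency, for a mechanism `M` (given by its
output laws) with the inputs in `D`. -/
def IsDP {Y : Type*} [MeasurableSpace Y] (D : Set Dataset) (M : Dataset → Measure Y)
    (ε δ : ℝ) : Prop :=
  ∀ X ∈ D, ∀ X' ∈ D, Adjacent X X' → ∀ S : Set Y, MeasurableSet S →
    M X S ≤ ENNReal.ofReal (Real.exp ε) * M X' S + ENNReal.ofReal δ

/-! ### Continual counting: the binary tree mechanism -/

/-- The centred Laplace distribution with scale `s`. -/
def laplace (s : ℝ) : Measure ℝ :=
  volume.withDensity (fun x => ENNReal.ofReal (1 / (2 * s) * Real.exp (-|x| / s)))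

/-- The number `⌈log₂ (m + 1)⌉` of levels of the tree. -/
def levels (m : ℕ) : ℕ := ⌈Real.logb 2 (m + 1)⌉₊

/-- The tree nodes: `(l, k)` stands for the dyadic interval `[k 2^l, (k + 1) 2^l)`. -/
abbrev Node (m : ℕ) := Fin (levels m) × Fin (2 ^ levels m)

/-- The node `I` occurs in the dyadic decomposition of `[0, i)`: this decomposition has one interval
of length `2^l` for every binary digit `1` of `i` at position `l`, which starts at the number formed
by the higher digits of `i`. -/
def InPrefix {m : ℕ} (i : ℕ) (I : Node m) : Prop :=
  i.testBit I.1.val = true ∧ I.2.val = 2 * (i / 2 ^ (I.1.val + 1))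

open Classical in
/-- The noise `∑ η_I` of the `i`-th prefix, the sum over the decomposition of `[0, i)`. -/
def prefixNoise {m : ℕ} (η : Node m → ℝ) (i : ℕ) : ℝ :=
  ∑ I : Node m, if InPrefix i I then η I else 0

/-- The law of `CC_ε(r_1, …, r_m)`: independent `Lap(T/ε)` noise in every node, `T` the number of
levels; each `r_i` plus the noise of its prefix, rounded to the nearest integer (ties upwards). -/
def continualCounting (m : ℕ) (ε : ℝ) (r : Fin m → ℤ) : Measure (Fin m → ℤ) :=
  (Measure.pi (fun _ : Node m => laplace (levels m / ε))).map
    (fun η i => round ((r i : ℝ) + prefixNoise η (i.val + 1)))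

/-! ### The exponential mechanism for a single quantile -/

/-- The law of `SingleQuantile_{t,ε}(S, (a, b))`, implemented as the exponential mechanism on
`(a, b)` with utility `z ↦ -| |{x ∈ S : x < z}| - t |`: the density at `z` is proportional to
`exp ((ε / 2) · utility)`. Being constant between consecutive points of `S`, this is the same as
sampling one of these intervals with probability proportional to its length times
`exp ((ε / 2) · utility)`, and then a uniform point of it. -/
def singleQuantile (t : ℕ) (ε : ℝ) (S : Dataset) (a b : ℝ) : Measure ℝ :=
  let μ := (volume.restrict (Ioo a b)).withDensity
    (fun z => ENNReal.ofReal (Real.exp (ε / 2 * (-|(rank S z : ℝ) - (t : ℝ)|))))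
  (μ univ)⁻¹ • μ

/-! ### The algorithm `SliceQuantiles` on the domain `(0, b)` -/

/-- The half-width `h = ⌈ℓ / 2⌉` of the slices. -/
def halfWidth (ℓ : ℝ) : ℕ := ⌈ℓ / 2⌉₊

/-- The slice `x_(r-h), …, x_(r+h)`. -/
def slice (X : Dataset) (b : ℝ) (h : ℕ) (r : ℤ) : Dataset :=
  (Multiset.range (2 * h + 1)).map (fun t => orderStat X b (r - h + t))

/-- Lower end of `ClipRange` for the index `j` after the indices `π 0, …, π (k-1)` were processed:
the largest estimate released so far for an index below `j` (or `0`). -/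
def clipLower {m : ℕ} (π : Equiv.Perm (Fin m)) (k : ℕ) (j : Fin m) (z : Fin m → ℝ) : ℝ :=
  (Finset.univ.filter (fun i : Fin m => (π.symm i).val < k ∧ i < j)).fold max 0 z

/-- Upper end of `ClipRange`: the smallest estimate released so far for an index above `j`
(or `b`). -/
def clipUpper {m : ℕ} (b : ℝ) (π : Equiv.Perm (Fin m)) (k : ℕ) (j : Fin m) (z : Fin m → ℝ) : ℝ :=
  (Finset.univ.filter (fun i : Fin m => (π.symm i).val < k ∧ j < i)).fold min b z

/-- The law of the estimates after `k` rounds of the main loop with noisy ranks `r`: round `k`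
handles the index `j = π k`, draws `z_j` by `SingleQuantile` on the slice of `j`, with target rank
`⌊|S_j| / 2⌋` and the clipped range. Coordinates that are not yet released are `0`. -/
def loop {m : ℕ} (b : ℝ) (h : ℕ) (ε₂ : ℝ) (π : Equiv.Perm (Fin m)) (X : Dataset)
    (r : Fin m → ℤ) : ℕ → Measure (Fin m → ℝ)
  | 0 => Measure.dirac 0
  | k + 1 =>
    if hk : k < m then
      let j : Fin m := π ⟨k, hk⟩
      let S : Dataset := slice X b h (r j)
      (loop b h ε₂ π X r k).bind (fun z =>
        (singleQuantile (S.card / 2) ε₂ S (clipLower π k j z) (clipUpper b π k j z)).map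
          (fun v => Function.update z j v))
    else loop b h ε₂ π X r k

/-- `m` independent uniform samples from `(0, b)`. -/
def uniformOutput (m : ℕ) (b : ℝ) : Measure (Fin m → ℝ) :=
  Measure.pi (fun _ : Fin m => ProbabilityTheory.cond volume (Ioo (0 : ℝ) b))

open Classical in
/-- The output law of `SliceQuantiles` on the dataset `X` with input ranks `r`, budgets `ε₁, ε₂`,
slice parameter `ℓ`, coin bias `γ`, order of release `π` and domain `(0, b)`. -/
def mechanism {m : ℕ} (b ε₁ ε₂ ℓ γ : ℝ) (π : Equiv.Perm (Fin m)) (r : Fin m → ℤ)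
    (X : Dataset) : Measure (Fin m → ℝ) :=
  (continualCounting m ε₁ r).bind (fun r' =>
    ENNReal.ofReal γ • uniformOutput m b +
    ENNReal.ofReal (1 - γ) •
      (if r' ∈ Good m X.card (halfWidth ℓ) then loop b (halfWidth ℓ) ε₂ π X r' m
        else uniformOutput m b))

/-- The input requirement of the algorithm, `r ∈ Good_{m, n, w + ⌈ℓ / 2⌉ + 1}`. -/
def Requirement {m : ℕ} (w ℓ : ℝ) (r : Fin m → ℤ) (n : ℕ) : Prop :=
  r ∈ Good m n (w + halfWidth ℓ + 1)

/-- The admissible inputs: datasets in `[0, b]` that meet the requirement of the algorithm. -/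
def inputs {m : ℕ} (b w ℓ : ℝ) (r : Fin m → ℤ) : Set Dataset :=
  {X | (∀ x ∈ X, x ∈ Icc (0 : ℝ) b) ∧ Requirement w ℓ r X.card}

/-- The error bound `w = 3 log m · log (2m/δ) / ε₁` of continual counting (logarithms to base 2). -/
def noiseBound (m : ℕ) (ε₁ δ : ℝ) : ℝ :=
  3 * Real.logb 2 m * Real.logb 2 (2 * m / δ) / ε₁

/-- The gap `Δ = 3 log m · log (2m/δ) / (ε₁ n) + 2 log (bm/β) / (ε₂ n)`. -/
def minGap (m n : ℕ) (b ε₁ ε₂ δ β : ℝ) : ℝ :=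
  3 * Real.logb 2 m * Real.logb 2 (2 * m / δ) / (ε₁ * n) +
    2 * Real.logb 2 (b * m / β) / (ε₂ * n)

end SliceQuantiles

end

namespace SliceQuantiles

/-! ### Order statistics -/

/-! Privacy. A point inserted at sorted position `p` leaves the order statistics below `p` alone and
moves the later ones up by one index. Outside an event of probability `δ`, every noisy rank is
within `w + 1/2` of its true rank (`continualCounting_compl_closeRanks_le`). Then a slice lying
below `p` does not change, and a slice lying above `p` reappears identically once its noisy rank is
shifted by one. True ranks are `2 (w + h + 1)` apart, so at most one slice is neither. The indices
to shift are chosen from the true ranks, hence form a final segment that does not depend on the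
noise. Shifting that segment amounts to translating the noise of the `T` tree nodes above one leaf,
at a cost of `exp ε₁` (`lintegral_continualCounting_le`). The exceptional slice interlaces with its
counterpart, so its ranks change by at most one, which costs `exp ε₂` (`loop_le_smul`). This yields
the budget `ε₁ + ε₂`, which is below the claimed `ε₁ + 2 ε₂`.

Error. On the event of close noisy ranks (now with `β` for `δ`) the slices occupy consecutive ranges
of data. As long as all released estimates lie in the ranges of their slices, clipping never cuts
into the next slice. Its middle gap has length at least one and full weight, whereas everything
outside the slice weighs at most `b exp (-ε₂ h / 2) ≤ β / m` (`le_singleQuantile_Ioc`). Over `m`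
rounds all estimates stay in their slices with probability at least `1 - β` (`le_loop_inSlices`),
and the rank error is then at most `h + w + 1/2`.

Gap. Multiplying the gap by `n` leaves a surplus of three, which pays for the roundings and the
extra `1` in the requirement. -/

theorem sort_cons_eq_orderedInsert (X : Dataset) (x : ℝ) :
    (x ::ₘ X).sort (· ≤ ·) = (X.sort (· ≤ ·)).orderedInsert (· ≤ ·) x := by
  refine List.Perm.eq_of_pairwise' (r := (· ≤ ·)) (Multiset.pairwise_sort _ _)
    ((Multiset.pairwise_sort X _).orderedInsert x _) ?_
  rw [← Multiset.coe_eq_coe, Multiset.sort_eq,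
    Multiset.coe_eq_coe.2 (List.perm_orderedInsert (· ≤ ·) x _), ← Multiset.cons_coe,
    Multiset.sort_eq]

/-- Inserting `x` shifts the order statistics above the position `p` of `x` by one and keeps those
below `p`. -/
theorem exists_insert_position (X : Dataset) (x b : ℝ) :
    ∃ p : ℤ, (∀ k < p, orderStat (x ::ₘ X) b k = orderStat X b k) ∧
      ∀ k, p < k → orderStat (x ::ₘ X) b k = orderStat X b (k - 1) := by
  set l := X.sort (· ≤ ·) with hl
  set u := l.takeWhile fun y => ¬ x ≤ y with hu
  set v := l.dropWhile fun y => ¬ x ≤ y with hv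
  have huv : l = u ++ v := (List.takeWhile_append_dropWhile).symm
  have hs : (x ::ₘ X).sort (· ≤ ·) = u ++ x :: v := by
    rw [sort_cons_eq_orderedInsert, List.orderedInsert_eq_take_drop]
  -- The list `u` holds the points strictly below `x`, so `x` itself lands at position `u.length +
  -- 1`. The default values `0` and `b` make both rules hold for all integers `k`.
  refine ⟨u.length + 1, fun k hk => ?_, fun k hk => ?_⟩
  · unfold orderStat
    split_ifs with h0
    · rfl
    · rw [hs, ← hl, huv, List.getD_append _ _ _ _ (by omega), List.getD_append _ _ _ _ (by omega)]
  · unfold orderStat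
    rw [if_neg (by omega), if_neg (by omega), hs, ← hl, huv,
      List.getD_append_right _ _ _ _ (by omega), List.getD_append_right _ _ _ _ (by omega)]
    have : k.toNat - 1 - u.length = ((k - 1).toNat - 1 - u.length) + 1 := by omega
    rw [this, List.getD_cons_succ]

theorem orderStat_eq_getElem (X : Dataset) (b : ℝ) {k : ℤ} (h1 : 1 ≤ k) (h2 : k ≤ X.card) :
    orderStat X b k = (X.sort (· ≤ ·))[k.toNat - 1]'(by rw [Multiset.length_sort]; omega) := by
  unfold orderStat
  rw [if_neg (by omega), List.getD_eq_getElem]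

theorem orderStat_eq_of_card_lt (X : Dataset) (b : ℝ) {k : ℤ} (h2 : X.card < k) :
    orderStat X b k = b := by
  unfold orderStat
  rw [if_neg (by omega), List.getD_eq_default]
  rw [Multiset.length_sort]; omega

theorem orderStat_mem_Icc {X : Dataset} {b : ℝ} (hb : 0 ≤ b) (hX : ∀ x ∈ X, x ∈ Icc 0 b) (k : ℤ) :
    orderStat X b k ∈ Icc 0 b := by
  rcases le_or_gt k 0 with h0 | h0
  · simp [orderStat, h0, hb]
  rcases le_or_gt k X.card with h1 | h1
  · rw [orderStat_eq_getElem X b (by omega) h1]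
    exact hX _ ((Multiset.mem_sort (r := (· ≤ ·))).1 (List.getElem_mem _))
  · rw [orderStat_eq_of_card_lt X b h1]
    exact ⟨hb, le_rfl⟩

theorem orderStat_mono {X : Dataset} {b : ℝ} (hb : 0 ≤ b) (hX : ∀ x ∈ X, x ∈ Icc 0 b) :
    Monotone (orderStat X b) := by
  intro k k' hk
  rcases le_or_gt k 0 with h0 | h0
  · simpa [orderStat, h0] using (orderStat_mem_Icc hb hX k').1
  rcases le_or_gt k' X.card with h1 | h1
  · rw [orderStat_eq_getElem X b (by omega) h1, orderStat_eq_getElem X b (by omega) (by omega)]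
    exact (Multiset.pairwise_sort X (· ≤ ·)).sortedLE.monotone_get
      (show (⟨k.toNat - 1, _⟩ : Fin _) ≤ ⟨k'.toNat - 1, _⟩ from by simp; omega)
  · rw [orderStat_eq_of_card_lt X b h1]
    exact (orderStat_mem_Icc hb hX k).2

theorem one_le_orderStat_sub {X : Dataset} {b : ℝ} (hX : HasUnitGap X) {k : ℤ} (h1 : 1 ≤ k)
    (h2 : k + 1 ≤ X.card) : 1 ≤ orderStat X b (k + 1) - orderStat X b k := by
  rw [orderStat_eq_getElem X b h1 (by omega), orderStat_eq_getElem X b (by omega) h2]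
  have hp : (X.sort (· ≤ ·)).Pairwise (fun x y => 1 ≤ |x - y|) := by
    obtain ⟨l, hl, hl'⟩ := hX
    refine (List.Perm.pairwise_iff (fun h => by rwa [abs_sub_comm]) ?_).1 hl'
    rw [← Multiset.coe_eq_coe, Multiset.sort_eq, hl]
  have hlt : k.toNat - 1 < (k + 1).toNat - 1 := by omega
  have hlen : (k + 1).toNat - 1 < (X.sort (· ≤ ·)).length := by
    rw [Multiset.length_sort]; omega
  have h3 := List.pairwise_iff_getElem.1 hp _ _ (by omega) hlen hlt
  have h4 := List.pairwise_iff_getElem.1 (Multiset.pairwise_sort X (· ≤ ·)) _ _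
    (by omega) hlen hlt
  rwa [abs_sub_comm, abs_of_nonneg (by linarith)] at h3

theorem rank_eq_countP_sort (X : Dataset) (z : ℝ) :
    rank X z = (X.sort (· ≤ ·)).countP (fun x => x < z) := by
  unfold rank
  conv_lhs => rw [← Multiset.sort_eq X (· ≤ ·)]
  rw [Multiset.filter_coe, Multiset.coe_card, List.countP_eq_length_filter]

theorem le_rank_of_orderStat_lt {X : Dataset} {b : ℝ} {k : ℤ} (h1 : 1 ≤ k)
    (h2 : k ≤ X.card) {z : ℝ} (hz : orderStat X b k < z) : k ≤ rank X z := by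
  rw [orderStat_eq_getElem X b h1 h2] at hz
  rw [rank_eq_countP_sort]
  set l := X.sort (· ≤ ·) with hl
  have hlen : l.length = X.card := Multiset.length_sort _
  have ht : (l.take k.toNat).countP (fun x => x < z) = (l.take k.toNat).length := by
    rw [List.countP_eq_length]
    intro a ha
    obtain ⟨i, hi, rfl⟩ := List.mem_iff_getElem.1 ha
    rw [List.length_take] at hi
    rw [List.getElem_take]
    refine decide_eq_true (lt_of_le_of_lt ?_ hz)
    exact (Multiset.pairwise_sort X (· ≤ ·)).sortedLE.monotone_get
      (show (⟨i, _⟩ : Fin _) ≤ ⟨k.toNat - 1, _⟩ from by simp; omega)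
  have := (List.take_sublist k.toNat l).countP_le (p := fun x => decide (x < z))
  rw [ht, List.length_take] at this
  omega

theorem rank_lt_of_le_orderStat {X : Dataset} {b : ℝ} {k : ℤ} (h1 : 1 ≤ k)
    (h2 : k ≤ X.card) {z : ℝ} (hz : z ≤ orderStat X b k) : (rank X z : ℤ) < k := by
  rw [orderStat_eq_getElem X b h1 h2] at hz
  rw [rank_eq_countP_sort]
  set l := X.sort (· ≤ ·) with hl
  have hlen : l.length = X.card := Multiset.length_sort _
  have ht : (l.drop (k.toNat - 1)).countP (fun x => x < z) = 0 := by
    rw [List.countP_eq_zero]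
    intro a ha
    obtain ⟨i, hi, rfl⟩ := List.mem_iff_getElem.1 ha
    rw [List.length_drop] at hi
    rw [List.getElem_drop]
    simp only [decide_eq_true_eq, not_lt]
    refine hz.trans ?_
    exact (Multiset.pairwise_sort X (· ≤ ·)).sortedLE.monotone_get
      (show (⟨k.toNat - 1, _⟩ : Fin _) ≤ ⟨k.toNat - 1 + i, _⟩ from by simp)
  have h3 : l.countP (fun x => x < z) = (l.take (k.toNat - 1)).countP (fun x => x < z) := by
    conv_lhs => rw [← List.take_append_drop (k.toNat - 1) l]
    rw [List.countP_append, ht, add_zero]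
  have h4 := List.countP_le_length (p := fun x => decide (x < z)) (l := l.take (k.toNat - 1))
  rw [List.length_take] at h4
  omega

theorem rank_mono (X : Dataset) : Monotone (rank X) := fun _ _ h =>
  Multiset.card_le_card (Multiset.monotone_filter_right X fun _ hx => lt_of_lt_of_le hx h)

theorem measurable_rank (X : Dataset) : Measurable (rank X) := (rank_mono X).measurable

/-! ### Slices -/

theorem slice_eq_map (X : Dataset) (b : ℝ) (h : ℕ) (r : ℤ) :
    slice X b h r = (Multiset.range (2 * h + 1)).map fun t : ℕ => orderStat X b (r - h + t) := by
  simp only [slice, Multiset.bind_def, Multiset.pure_def, Multiset.bind_singleton,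
    Multiset.map_map, Function.comp_def]

theorem card_slice (X : Dataset) (b : ℝ) (h : ℕ) (r : ℤ) : (slice X b h r).card = 2 * h + 1 := by
  rw [slice_eq_map, Multiset.card_map, Multiset.card_range]

theorem rank_slice (X : Dataset) (b : ℝ) (h : ℕ) (r : ℤ) (z : ℝ) :
    rank (slice X b h r) z =
      ((Finset.range (2 * h + 1)).filter (fun t : ℕ => orderStat X b (r - h + t) < z)).card := by
  rw [rank, slice_eq_map, Multiset.filter_map, Multiset.card_map]
  rfl

theorem slice_congr {X X' : Dataset} {b : ℝ} {h : ℕ} {r r' : ℤ}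
    (H : ∀ t : ℕ, t ≤ 2 * h → orderStat X b (r - h + t) = orderStat X' b (r' - h + t)) :
    slice X b h r = slice X' b h r' := by
  rw [slice_eq_map, slice_eq_map]
  refine Multiset.map_congr rfl fun t ht => H t ?_
  rw [Multiset.mem_range] at ht
  omega

/-- Interlacing datasets have slices whose ranks differ by at most one. -/
theorem abs_rank_slice_sub_le {X X' : Dataset} {b : ℝ} (h : ℕ) (r : ℤ)
    (h1 : ∀ k, orderStat X b (k - 1) ≤ orderStat X' b k)
    (h2 : ∀ k, orderStat X' b k ≤ orderStat X b k) (z : ℝ) :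
    |(rank (slice X b h r) z : ℝ) - rank (slice X' b h r) z| ≤ 1 := by
  rw [rank_slice, rank_slice]
  set A := (Finset.range (2 * h + 1)).filter (fun t : ℕ => orderStat X b (r - h + t) < z)
  set A' := (Finset.range (2 * h + 1)).filter (fun t : ℕ => orderStat X' b (r - h + t) < z)
  have hA : A ⊆ A' := fun t ht => by
    simp only [A, A', Finset.mem_filter] at ht ⊢
    exact ⟨ht.1, (h2 _).trans_lt ht.2⟩
  -- Interlacing puts the predecessor of every positive index of `A'` into `A`; only the index `0`
  -- has none.
  have hA' : A' ⊆ insert 0 (A.image (· + 1)) := fun t ht => by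
    simp only [A, A', Finset.mem_filter, Finset.mem_range, Finset.mem_insert,
      Finset.mem_image] at ht ⊢
    rcases t with _ | t
    · exact Or.inl rfl
    · refine Or.inr ⟨t, ⟨by omega, lt_of_le_of_lt ?_ ht.2⟩, rfl⟩
      have := h1 (r - h + (t + 1 : ℕ))
      rwa [show r - h + ((t + 1 : ℕ) : ℤ) - 1 = r - h + t by push_cast; ring] at this
  have c1 := Finset.card_le_card hA
  have c2 := ((Finset.card_le_card hA').trans (Finset.card_insert_le _ _)).trans
    (Nat.add_le_add_right Finset.card_image_le 1)
  have c1' : (A.card : ℝ) ≤ A'.card := by exact_mod_cast c1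
  have c2' : (A'.card : ℝ) ≤ A.card + 1 := by exact_mod_cast c2
  rw [abs_le]
  constructor <;> linarith

/-- Away from the insertion position one of the two inequalities is an equality; the rest is
monotonicity of the order statistics of the larger dataset. -/
theorem orderStat_interlace {X : Dataset} {x b : ℝ} (hb : 0 ≤ b)
    (hX : ∀ y ∈ x ::ₘ X, y ∈ Icc 0 b) (k : ℤ) :
    orderStat X b (k - 1) ≤ orderStat (x ::ₘ X) b k ∧
      orderStat (x ::ₘ X) b k ≤ orderStat X b k := by
  obtain ⟨p, hp1, hp2⟩ := exists_insert_position X x b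
  have hm := orderStat_mono hb hX
  constructor
  · rcases le_or_gt k p with h | h
    · rw [← hp1 (k - 1) (by omega)]
      exact hm (by omega)
    · rw [hp2 k h]
  · rcases lt_or_ge k p with h | h
    · rw [hp1 k h]
    · have := hp2 (k + 1) (by omega)
      rw [add_sub_cancel_right] at this
      rw [← this]
      exact hm (by omega)

theorem rank_slice_eq_half {X : Dataset} {b : ℝ} (hm : Monotone (orderStat X b)) {h : ℕ} {r : ℤ}
    {z : ℝ} (h1 : orderStat X b (r - 1) < z) (h2 : z ≤ orderStat X b r) :
    rank (slice X b h r) z = h := by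
  rw [rank_slice]
  convert Finset.card_range h using 2
  ext t
  simp only [Finset.mem_filter, Finset.mem_range]
  constructor
  · rintro ⟨-, ht⟩
    by_contra hc
    exact absurd (ht.trans_le h2) (not_lt.2 (hm (by omega)))
  · intro ht
    exact ⟨by omega, (hm (by omega)).trans_lt h1⟩

theorem rank_slice_eq_zero {X : Dataset} {b : ℝ} (hm : Monotone (orderStat X b)) {h : ℕ} {r : ℤ}
    {z : ℝ} (hz : z ≤ orderStat X b (r - h)) : rank (slice X b h r) z = 0 := by
  rw [rank_slice, Finset.card_eq_zero, Finset.filter_eq_empty_iff]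
  exact fun t _ => not_lt.2 (hz.trans (hm (by omega)))

theorem rank_slice_eq_card {X : Dataset} {b : ℝ} (hm : Monotone (orderStat X b)) {h : ℕ} {r : ℤ}
    {z : ℝ} (hz : orderStat X b (r + h) < z) : rank (slice X b h r) z = 2 * h + 1 := by
  rw [rank_slice, Finset.filter_true_of_mem, Finset.card_range]
  intro t ht
  rw [Finset.mem_range] at ht
  exact (hm (by omega)).trans_lt hz

/-! ### The gap condition -/

theorem requirement_of_hasQuantileGap {m n : ℕ} {b ε₁ ε₂ δ β ℓ : ℝ} {q : Fin m → ℝ}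
    (hm : 2 ≤ m) (hn : 1 ≤ n) (hb : 1 < b) (hε₁ : 0 < ε₁) (hε₂ : 0 < ε₂) (hβ0 : 0 < β)
    (hβ : β < 1) (hℓ : ℓ = 4 * Real.logb 2 (b * m / β) / ε₂)
    (hq : HasQuantileGap q (minGap m n b ε₁ ε₂ δ β + 3 / n)) :
    Requirement (noiseBound m ε₁ δ) ℓ (targetRank q n) n := by
  have hn' : (0 : ℝ) < n := by exact_mod_cast hn
  have hm' : (2 : ℝ) ≤ m := by exact_mod_cast hm
  have hlog : 0 ≤ Real.logb 2 (b * m / β) := by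
    refine Real.logb_nonneg one_lt_two ?_
    rw [le_div_iff₀ hβ0]
    nlinarith
  have hℓ0 : 0 ≤ ℓ := by rw [hℓ]; positivity
  have hceil : (halfWidth ℓ : ℝ) < ℓ / 2 + 1 := Nat.ceil_lt_add_one (by positivity)
  -- The surplus `3` covers the ceiling in `h`, the `1` in the requirement, and the floor in the
  -- target ranks, each at most one.
  have hgap : (minGap m n b ε₁ ε₂ δ β + 3 / n) * n = noiseBound m ε₁ δ + ℓ / 2 + 3 := by
    rw [hℓ, minGap, noiseBound]
    field_simp
    ring
  set D := minGap m n b ε₁ ε₂ δ β + 3 / n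
  set w := noiseBound m ε₁ δ
  obtain ⟨h1, h2, h3⟩ := hq
  refine ⟨fun i hi => ?_, fun i j hij => ?_, fun i hi => ?_⟩
  · have := Int.sub_one_lt_floor (q i * n)
    have := mul_le_mul_of_nonneg_right (h1 i hi) hn'.le
    simp only [targetRank]
    linarith
  · have := Int.sub_one_lt_floor (q j * n)
    have := Int.floor_le (q i * n)
    have := mul_le_mul_of_nonneg_right (h2 i j hij) hn'.le
    simp only [targetRank]
    linarith
  · have := Int.floor_le (q i * n)
    have := mul_le_mul_of_nonneg_right (h3 i hi) hn'.le
    simp only [targetRank]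
    linarith

end SliceQuantiles

namespace SliceQuantiles

/-! ### The Laplace distribution -/

/-- The moment generating function drives the Chernoff bound; `t = 0` gives the total mass. -/
theorem lintegral_exp_mul_laplace {s t : ℝ} (hs : 0 < s) (ht : |t * s| < 1) :
    ∫⁻ x, ENNReal.ofReal (Real.exp (t * x)) ∂laplace s =
      ENNReal.ofReal (1 / (1 - (t * s) ^ 2)) := by
  obtain ⟨ht1, ht2⟩ := abs_lt.1 ht
  rw [laplace, lintegral_withDensity_eq_lintegral_mul _ (by fun_prop) (by fun_prop)]
  have hl : 0 < 1 / s + t := by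
    rw [show 1 / s + t = (1 + t * s) / s by field_simp]
    exact div_pos (by linarith) hs
  have hr : t - 1 / s < 0 := by
    rw [show t - 1 / s = -((1 - t * s) / s) by field_simp; ring]
    exact neg_neg_of_pos (div_pos (by linarith) hs)
  have e1 : ∫⁻ x in Iic (0 : ℝ), ENNReal.ofReal (1 / (2 * s) * Real.exp (-|x| / s)) *
      ENNReal.ofReal (Real.exp (t * x)) = ENNReal.ofReal (1 / (2 * (1 + t * s))) := by
    have : ∀ x ∈ Iic (0 : ℝ), ENNReal.ofReal (1 / (2 * s) * Real.exp (-|x| / s)) *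
        ENNReal.ofReal (Real.exp (t * x)) =
        ENNReal.ofReal (1 / (2 * s) * Real.exp ((1 / s + t) * x)) := by
      intro x hx
      rw [← ENNReal.ofReal_mul (by positivity), mul_assoc, ← Real.exp_add,
        abs_of_nonpos (mem_Iic.1 hx)]
      congr 3
      ring
    rw [setLIntegral_congr_fun measurableSet_Iic this,
      ← ofReal_integral_eq_lintegral_ofReal ((integrableOn_exp_mul_Iic hl 0).const_mul _)
        (ae_of_all _ fun x => by positivity),
      integral_const_mul, integral_exp_mul_Iic hl, mul_zero, Real.exp_zero]
    congr 1
    have : 1 + t * s ≠ 0 := by linarith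
    field_simp
  have e2 : ∫⁻ x in Ioi (0 : ℝ), ENNReal.ofReal (1 / (2 * s) * Real.exp (-|x| / s)) *
      ENNReal.ofReal (Real.exp (t * x)) = ENNReal.ofReal (1 / (2 * (1 - t * s))) := by
    have : ∀ x ∈ Ioi (0 : ℝ), ENNReal.ofReal (1 / (2 * s) * Real.exp (-|x| / s)) *
        ENNReal.ofReal (Real.exp (t * x)) =
        ENNReal.ofReal (1 / (2 * s) * Real.exp ((t - 1 / s) * x)) := by
      intro x hx
      rw [← ENNReal.ofReal_mul (by positivity), mul_assoc, ← Real.exp_add,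
        abs_of_pos (mem_Ioi.1 hx)]
      congr 3
      ring
    rw [setLIntegral_congr_fun measurableSet_Ioi this,
      ← ofReal_integral_eq_lintegral_ofReal ((integrableOn_exp_mul_Ioi hr 0).const_mul _)
        (ae_of_all _ fun x => by positivity),
      integral_const_mul, integral_exp_mul_Ioi hr, mul_zero, Real.exp_zero]
    congr 1
    have h1 : 1 - t * s ≠ 0 := by linarith
    rw [show t - 1 / s = -((1 - t * s) / s) by field_simp; ring]
    field_simp
  have h1 : 0 < 1 + t * s := by linarith
  have h2 : 0 < 1 - t * s := by linarith
  simp only [Pi.mul_apply]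
  rw [← lintegral_add_compl _ (measurableSet_Iic (a := (0 : ℝ))), compl_Iic, e1, e2,
    ← ENNReal.ofReal_add (by positivity) (by positivity)]
  congr 1
  rw [show 1 - (t * s) ^ 2 = (1 + t * s) * (1 - t * s) by ring]
  field_simp
  ring

theorem isProbabilityMeasure_laplace {s : ℝ} (hs : 0 < s) : IsProbabilityMeasure (laplace s) :=
  ⟨by simpa using lintegral_exp_mul_laplace (t := 0) hs (by simp)⟩

theorem map_add_laplace (s d : ℝ) (hs : 0 < s) :
    (laplace s).map (· + d) =
      (laplace s).withDensity fun x => ENNReal.ofReal (Real.exp ((|x| - |x - d|) / s)) := by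
  ext A hA
  rw [Measure.map_apply (by fun_prop) hA, laplace,
    withDensity_apply _ (hA.preimage (by fun_prop)), ← withDensity_mul _ (by fun_prop)
      (by fun_prop), withDensity_apply _ hA,
    ← lintegral_indicator (hA.preimage (by fun_prop)), ← lintegral_indicator hA,
    ← lintegral_sub_right_eq_self _ d]
  congr 1 with x
  by_cases hx : x ∈ A
  · rw [indicator_of_mem (by simpa using hx), indicator_of_mem hx, Pi.mul_apply]
    rw [← ENNReal.ofReal_mul (by positivity), mul_assoc, ← Real.exp_add]
    congr 3
    ring
  · rw [indicator_of_notMem (by simpa using hx), indicator_of_notMem hx]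

/-! ### Independent Laplace noise: translations and tails -/

theorem lintegral_pi_prod {ι : Type*} [Fintype ι] {E : ι → Type*} [∀ i, MeasurableSpace (E i)]
    (μ : ∀ i, Measure (E i)) [∀ i, IsProbabilityMeasure (μ i)] {f : ∀ i, E i → ℝ≥0∞}
    (hf : ∀ i, Measurable (f i)) (J : Finset ι) :
    ∫⁻ x, ∏ i ∈ J, f i (x i) ∂Measure.pi μ = ∏ i ∈ J, ∫⁻ y, f i y ∂μ i := by
  rw [ProbabilityTheory.lintegral_prod_eq_prod_lintegral_of_indepFun J
    (fun i (x : ∀ i, E i) => f i (x i))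
    (ProbabilityTheory.iIndepFun_pi fun i => (hf i).aemeasurable)
    fun i => (hf i).comp (measurable_pi_apply i)]
  exact Finset.prod_congr rfl fun i _ => (measurePreserving_eval μ i).lintegral_comp (hf i)

theorem pi_withDensity {ι : Type*} [Fintype ι] {E : ι → Type*} [∀ i, MeasurableSpace (E i)]
    (μ : ∀ i, Measure (E i)) [∀ i, IsProbabilityMeasure (μ i)] {f : ∀ i, E i → ℝ≥0∞}
    (hf : ∀ i, Measurable (f i)) [∀ i, SigmaFinite ((μ i).withDensity (f i))] :
    Measure.pi (fun i => (μ i).withDensity (f i)) =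
      (Measure.pi μ).withDensity fun x => ∏ i, f i (x i) := by
  refine Measure.pi_eq fun A hA => ?_
  rw [withDensity_apply _ (MeasurableSet.univ_pi hA),
    ← lintegral_indicator (MeasurableSet.univ_pi hA)]
  have : ∀ x, (univ.pi A).indicator (fun x => ∏ i, f i (x i)) x =
      ∏ i, (A i).indicator (f i) (x i) := by
    intro x
    by_cases hx : x ∈ univ.pi A
    · rw [indicator_of_mem hx]
      exact Finset.prod_congr rfl fun i _ => (indicator_of_mem (hx i (mem_univ i)) _).symm
    · rw [indicator_of_notMem hx]
      obtain ⟨i, hi⟩ : ∃ i, x i ∉ A i := by simpa [mem_univ_pi] using hx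
      exact (Finset.prod_eq_zero (Finset.mem_univ i) (indicator_of_notMem hi _)).symm
  simp only [this]
  rw [lintegral_pi_prod μ (fun i => (hf i).indicator (hA i)) Finset.univ]
  exact Finset.prod_congr rfl fun i _ => by
    rw [lintegral_indicator (hA i), withDensity_apply _ (hA i)]

/-- Translating independent Laplace noise by `d` changes its law by a factor `exp (‖d‖₁ / s)`. -/
theorem map_add_pi_laplace_le {ι : Type*} [Fintype ι] {s : ℝ} (hs : 0 < s) (d : ι → ℝ) :
    (Measure.pi fun _ : ι => laplace s).map (· + d) ≤
      ENNReal.ofReal (Real.exp ((∑ i, |d i|) / s)) • Measure.pi fun _ : ι => laplace s := by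
  have := isProbabilityMeasure_laplace hs
  have hmeas : ∀ i : ι, Measurable fun x : ℝ =>
      ENNReal.ofReal (Real.exp ((|x| - |x - d i|) / s)) := fun i => by fun_prop
  have : ∀ i, IsProbabilityMeasure ((laplace s).map (· + d i)) := fun i =>
    Measure.isProbabilityMeasure_map (by fun_prop)
  have : ∀ i, SigmaFinite ((laplace s).withDensity fun x =>
      ENNReal.ofReal (Real.exp ((|x| - |x - d i|) / s))) := fun i => by
    rw [← map_add_laplace s (d i) hs]; infer_instance
  have h := Measure.pi_map_pi (μ := fun _ : ι => laplace s) (f := fun i x => x + d i)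
    (fun i => by fun_prop)
  simp only [map_add_laplace s _ hs] at h
  rw [pi_withDensity _ hmeas] at h
  change Measure.map (fun (x : ι → ℝ) i => x i + d i) _ ≤ _
  rw [h, ← withDensity_const]
  refine withDensity_mono (ae_of_all _ fun x => ?_)
  simp only
  rw [← ENNReal.ofReal_prod_of_nonneg fun i _ => by positivity, ← Real.exp_sum,
    ← Finset.sum_div]
  gcongr with i
  have := abs_add_le (x i - d i) (d i)
  rw [sub_add_cancel] at this
  linarith

theorem lintegral_pi_laplace_le {ι : Type*} [Fintype ι] {s : ℝ} (hs : 0 < s) (d : ι → ℝ)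
    {F : (ι → ℝ) → ℝ≥0∞} (hF : Measurable F) :
    ∫⁻ η, F η ∂Measure.pi (fun _ : ι => laplace s) ≤
      ENNReal.ofReal (Real.exp ((∑ i, |d i|) / s)) *
        ∫⁻ η, F (η + d) ∂Measure.pi (fun _ : ι => laplace s) := by
  calc ∫⁻ η, F η ∂Measure.pi (fun _ : ι => laplace s)
      = ∫⁻ η, F (η + d) ∂(Measure.pi fun _ : ι => laplace s).map (· + -d) := by
        rw [lintegral_map (by fun_prop) (by fun_prop)]
        simp
    _ ≤ ∫⁻ η, F (η + d) ∂(ENNReal.ofReal (Real.exp ((∑ i, |(-d) i|) / s)) •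
          Measure.pi fun _ : ι => laplace s) :=
        lintegral_mono' (map_add_pi_laplace_le hs (-d)) le_rfl
    _ = _ := by simp [lintegral_smul_measure]

/-- Chernoff bound for sums of independent Laplace variables. -/
theorem pi_laplace_le_exp {ι : Type*} [Fintype ι] {s t : ℝ} (hs : 0 < s) (ht : |t * s| < 1)
    (J : Finset ι) (c : ℝ) :
    Measure.pi (fun _ : ι => laplace s) {η | c ≤ t * ∑ i ∈ J, η i} ≤
      ENNReal.ofReal (Real.exp (-c) * (1 / (1 - (t * s) ^ 2)) ^ J.card) := by
  have := isProbabilityMeasure_laplace hs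
  have hpos : 0 ≤ 1 / (1 - (t * s) ^ 2) := by
    have := (sq_lt_one_iff_abs_lt_one _).2 ht
    exact one_div_nonneg.2 (by linarith)
  have h1 : ∫⁻ η, ∏ i ∈ J, ENNReal.ofReal (Real.exp (t * η i))
      ∂Measure.pi (fun _ : ι => laplace s) =
      ENNReal.ofReal (1 / (1 - (t * s) ^ 2)) ^ J.card := by
    rw [lintegral_pi_prod (fun _ : ι => laplace s)
      (f := fun _ x => ENNReal.ofReal (Real.exp (t * x))) (fun _ => by fun_prop) J]
    simp [lintegral_exp_mul_laplace hs ht]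
  have h2 := meas_ge_le_lintegral_div (μ := Measure.pi (fun _ : ι => laplace s))
    (f := fun η : ι → ℝ => ∏ i ∈ J, ENNReal.ofReal (Real.exp (t * η i)))
    (Measurable.aemeasurable (by fun_prop)) (ε := ENNReal.ofReal (Real.exp c))
    (by simpa using Real.exp_pos c) ENNReal.ofReal_ne_top
  rw [h1] at h2
  refine (measure_mono fun η hη => ?_).trans (h2.trans_eq ?_)
  · simp only [mem_ofPred_eq] at hη ⊢
    rw [← ENNReal.ofReal_prod_of_nonneg fun i _ => by positivity, ← Real.exp_sum,
      ← Finset.mul_sum]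
    gcongr
  · rw [Real.exp_neg, ENNReal.ofReal_mul (by positivity),
      ENNReal.ofReal_inv_of_pos (Real.exp_pos c), ENNReal.ofReal_pow hpos, ENNReal.div_eq_inv_mul]

theorem pi_laplace_abs_gt_le {ι : Type*} [Fintype ι] {s t : ℝ} (hs : 0 < s) (ht0 : 0 < t)
    (ht : t * s < 1) (J : Finset ι) (y : ℝ) :
    Measure.pi (fun _ : ι => laplace s) {η | y < |∑ i ∈ J, η i|} ≤
      ENNReal.ofReal (2 * (Real.exp (-(t * y)) * (1 / (1 - (t * s) ^ 2)) ^ J.card)) := by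
  have hts : |t * s| < 1 := by rwa [abs_of_pos (by positivity)]
  have hpos : 0 ≤ 1 / (1 - (t * s) ^ 2) := by
    have := (sq_lt_one_iff_abs_lt_one _).2 hts
    exact one_div_nonneg.2 (by linarith)
  have h1 := pi_laplace_le_exp hs hts J (t * y)
  have h2 := pi_laplace_le_exp hs (t := -t) (by rwa [neg_mul, abs_neg]) J (t * y)
  rw [neg_mul, neg_sq] at h2
  rw [two_mul, ENNReal.ofReal_add (by positivity) (by positivity)]
  refine (measure_mono fun η hη => ?_).trans
    ((measure_union_le _ _).trans (add_le_add h1 h2))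
  simp only [mem_ofPred_eq, mem_union] at hη ⊢
  rcases lt_abs.1 hη with h | h
  · exact Or.inl (mul_le_mul_of_nonneg_left h.le ht0.le)
  · refine Or.inr ?_
    rw [neg_mul, ← mul_neg]
    exact mul_le_mul_of_nonneg_left h.le ht0.le

end SliceQuantiles

namespace SliceQuantiles

/-! ### The binary tree -/

theorem lt_two_pow_levels (m : ℕ) : m < 2 ^ levels m := by
  have h : Real.logb 2 ((m : ℝ) + 1) ≤ levels m := Nat.le_ceil _
  rw [Real.logb_le_iff_le_rpow one_lt_two (by positivity), Real.rpow_natCast] at h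
  have : m + 1 ≤ 2 ^ levels m := by exact_mod_cast h
  omega

theorem two_pow_levels_le {m : ℕ} (hm : 1 ≤ m) : 2 ^ levels m ≤ 2 * m := by
  have hpos : 0 < levels m := by
    by_contra h0
    have := lt_two_pow_levels m
    rw [Nat.eq_zero_of_not_pos h0] at this
    omega
  obtain ⟨T, hT⟩ : ∃ T, levels m = T + 1 := ⟨levels m - 1, by omega⟩
  rw [hT, pow_succ, mul_comm]
  refine Nat.mul_le_mul_left 2 ?_
  by_contra hc
  have h1 : ((m : ℝ) + 1) ≤ 2 ^ (T : ℝ) := by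
    rw [Real.rpow_natCast]
    exact_mod_cast Nat.lt_of_not_le hc
  have h2 : levels m ≤ T :=
    Nat.ceil_le.2 ((Real.logb_le_iff_le_rpow one_lt_two (by positivity)).2 h1)
  omega

theorem levels_pos {m : ℕ} (hm : 1 ≤ m) : 0 < levels m := by
  by_contra h0
  have := lt_two_pow_levels m
  rw [Nat.eq_zero_of_not_pos h0] at this
  omega

/-- Exactly one interval of the dyadic decomposition of `[0, i)` contains `t` if `t < i`, and none
otherwise. -/
theorem sum_dyadic_decomposition (T : ℕ) : ∀ i t : ℕ, i < 2 ^ T → t < 2 ^ T →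
    (∑ l ∈ Finset.range T,
      if i.testBit l = true ∧ t / 2 ^ l = 2 * (i / 2 ^ (l + 1)) then 1 else 0) =
      if t < i then 1 else 0 := by
  induction T with
  | zero => intro i t hi ht; simp at hi ht; simp [hi, ht]
  | succ T ih =>
    intro i t hi ht
    rw [pow_succ] at hi ht
    -- Split off the unit intervals. The longer ones, halved, form the decomposition for `i / 2` and
    -- `t / 2`; the unit interval is present only for odd `i` and is then `{i - 1}`.
    rw [Finset.sum_range_succ']
    have h := ih (i / 2) (t / 2) (by omega) (by omega)
    have h' : ∀ l, (if i.testBit (l + 1) = true ∧ t / 2 ^ (l + 1) = 2 * (i / 2 ^ (l + 1 + 1))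
        then 1 else 0) = if (i / 2).testBit l = true ∧ t / 2 / 2 ^ l = 2 * (i / 2 / 2 ^ (l + 1))
        then 1 else 0 := by
      intro l
      rw [Nat.testBit_add_one, Nat.div_div_eq_div_mul, Nat.div_div_eq_div_mul, pow_succ' 2 l,
        pow_succ' 2 (l + 1), pow_succ' 2 l]
    simp only [h', h]
    simp only [Nat.testBit_zero, decide_eq_true_eq, pow_zero, Nat.div_one, zero_add, pow_one]
    split_ifs <;> omega

open Classical in
/-- The nodes of the decomposition of `[0, i)`. -/
noncomputable def prefixNodes (m i : ℕ) : Finset (Node m) :=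
  Finset.univ.filter (InPrefix i)

theorem prefixNoise_eq_sum {m : ℕ} (η : Node m → ℝ) (i : ℕ) :
    prefixNoise η i = ∑ I ∈ prefixNodes m i, η I := by
  rw [prefixNoise, prefixNodes, Finset.sum_filter]

theorem mem_prefixNodes {m i : ℕ} {I : Node m} : I ∈ prefixNodes m i ↔ InPrefix i I := by
  simp [prefixNodes]

theorem inPrefix_unique {m i : ℕ} {I J : Node m} (hI : InPrefix i I) (hJ : InPrefix i J)
    (h : I.1 = J.1) : I = J := by
  refine Prod.ext h (Fin.ext ?_)
  rw [hI.2, hJ.2, h]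

theorem card_prefixNodes_le (m i : ℕ) : (prefixNodes m i).card ≤ levels m := by
  have := Finset.card_le_card_of_injOn (s := prefixNodes m i) (t := Finset.univ)
    (fun I => I.1) (fun _ _ => Finset.mem_univ _) fun I hI J hJ h =>
      inPrefix_unique (mem_prefixNodes.1 hI) (mem_prefixNodes.1 hJ) h
  simpa using this

/-- A power of two has a single binary digit `1`. This sharpening is needed for `m = 2`, where both
prefix lengths are powers of two. -/
theorem card_prefixNodes_two_pow (m a : ℕ) : (prefixNodes m (2 ^ a)).card ≤ 1 := by
  refine Finset.card_le_one.2 fun I hI J hJ => ?_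
  rw [mem_prefixNodes] at hI hJ
  have h1 := hI.1
  have h2 := hJ.1
  rw [Nat.testBit_two_pow, decide_eq_true_eq] at h1 h2
  exact inPrefix_unique hI hJ (Fin.ext (h1.symm.trans h2))

/-- Noise `σ` on all nodes above the leaf `t`. -/
noncomputable def leafShift (m t : ℕ) (σ : ℝ) (I : Node m) : ℝ :=
  if I.2.val = t / 2 ^ I.1.val then σ else 0

theorem sum_leafShift {m t : ℕ} (ht : t < 2 ^ levels m) (g : Fin (levels m) → ℝ) :
    ∑ I : Node m, (if I.2.val = t / 2 ^ I.1.val then g I.1 else 0) = ∑ l, g l := by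
  rw [Fintype.sum_prod_type]
  refine Finset.sum_congr rfl fun l _ => ?_
  have hlt : t / 2 ^ l.val < 2 ^ levels m := (Nat.div_le_self _ _).trans_lt ht
  rw [Finset.sum_eq_single (⟨t / 2 ^ l.val, hlt⟩ : Fin (2 ^ levels m))]
  · simp
  · intro k _ hk
    exact if_neg fun h => hk (Fin.ext h)
  · simp

theorem sum_abs_leafShift {m t : ℕ} (ht : t < 2 ^ levels m) (σ : ℝ) :
    ∑ I : Node m, |leafShift m t σ I| = levels m * |σ| := by
  have := sum_leafShift ht (fun _ => |σ|)
  simp only [Finset.sum_const, Finset.card_univ, Fintype.card_fin, nsmul_eq_mul] at this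
  rw [← this]
  refine Finset.sum_congr rfl fun I _ => ?_
  unfold leafShift
  split_ifs <;> simp

-- The decomposition of `[0, i)` meets the path above leaf `t` in exactly one node if `t < i` and in
-- none otherwise. A translation of `ℓ¹` norm `T |σ|` therefore moves precisely the prefixes that
-- contain `t`.
open Classical in
theorem prefixNoise_leafShift {m t i : ℕ} (ht : t < 2 ^ levels m) (hi : i < 2 ^ levels m)
    (σ : ℝ) : prefixNoise (leafShift m t σ) i = if t < i then σ else 0 := by
  have h1 : ∀ I : Node m, (if InPrefix i I then leafShift m t σ I else 0) =
      if I.2.val = t / 2 ^ I.1.val then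
        (if i.testBit I.1.val = true ∧ t / 2 ^ I.1.val = 2 * (i / 2 ^ (I.1.val + 1))
          then σ else 0) else 0 := by
    intro I
    unfold leafShift InPrefix
    split_ifs <;> grind
  rw [prefixNoise]
  simp only [h1]
  rw [sum_leafShift ht fun l => if i.testBit l.val = true ∧
    t / 2 ^ l.val = 2 * (i / 2 ^ (l.val + 1)) then σ else 0]
  rw [Fin.sum_univ_eq_sum_range (fun l => if i.testBit l = true ∧
    t / 2 ^ l = 2 * (i / 2 ^ (l + 1)) then σ else 0)]
  have h2 := congrArg (fun n : ℕ => (n : ℝ) * σ) (sum_dyadic_decomposition _ i t hi ht)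
  simp only [Nat.cast_sum, Nat.cast_ite, Nat.cast_one, Nat.cast_zero, Finset.sum_mul, ite_mul,
    one_mul, zero_mul] at h2
  exact h2

theorem prefixNoise_add {m : ℕ} (η d : Node m → ℝ) (i : ℕ) :
    prefixNoise (η + d) i = prefixNoise η i + prefixNoise d i := by
  simp only [prefixNoise_eq_sum, Pi.add_apply, Finset.sum_add_distrib]

/-! ### Continual counting -/

theorem measurable_prefixNoise {m : ℕ} (i : ℕ) :
    Measurable fun η : Node m → ℝ => prefixNoise η i := by
  simp only [prefixNoise_eq_sum]
  fun_prop

theorem measurable_noisyRanks {m : ℕ} (r : Fin m → ℤ) :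
    Measurable fun (η : Node m → ℝ) (i : Fin m) =>
      round ((r i : ℝ) + prefixNoise η (i.val + 1)) := by
  refine measurable_pi_lambda _ fun i => ?_
  simp only [round_eq]
  exact ((measurable_const.add (measurable_prefixNoise _)).add_const _).floor

theorem scale_pos {m : ℕ} (hm : 1 ≤ m) {ε : ℝ} (hε : 0 < ε) : 0 < (levels m : ℝ) / ε :=
  div_pos (by exact_mod_cast levels_pos hm) hε

theorem isProbabilityMeasure_continualCounting {m : ℕ} (hm : 1 ≤ m) {ε : ℝ} (hε : 0 < ε)
    (r : Fin m → ℤ) : IsProbabilityMeasure (continualCounting m ε r) := by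
  have := isProbabilityMeasure_laplace (scale_pos hm hε)
  exact Measure.isProbabilityMeasure_map (measurable_noisyRanks r).aemeasurable

/-- Privacy of continual counting: the law of the noisy ranks changes by a factor `exp ε` when all
ranks from some index on are shifted by `σ ∈ {-1, 0, 1}`. -/
theorem lintegral_continualCounting_le {m : ℕ} (hm : 1 ≤ m) {ε : ℝ} (hε : 0 < ε)
    (r : Fin m → ℤ) {t : ℕ} (ht : t ≤ m) {σ : ℤ} (hσ : |σ| ≤ 1) (f : (Fin m → ℤ) → ℝ≥0∞) :
    ∫⁻ v, f v ∂continualCounting m ε r ≤ ENNReal.ofReal (Real.exp ε) *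
      ∫⁻ v, f (fun j => v j + if t ≤ j.val then σ else 0) ∂continualCounting m ε r := by
  have hT := lt_two_pow_levels m
  have hf : ∀ g : (Fin m → ℤ) → ℝ≥0∞, Measurable g := fun g => Measurable.of_discrete
  have hs := scale_pos hm hε
  rw [continualCounting, lintegral_map (hf _) (measurable_noisyRanks r),
    lintegral_map (hf _) (measurable_noisyRanks r)]
  refine (lintegral_pi_laplace_le hs (leafShift m t σ)
    ((hf f).comp (measurable_noisyRanks r))).trans ?_
  refine mul_le_mul' (ENNReal.ofReal_le_ofReal (Real.exp_le_exp.2 ?_))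
    (lintegral_mono fun η => le_of_eq ?_)
  · rw [sum_abs_leafShift (by omega), div_le_iff₀ hs, mul_div_cancel₀ _ hε.ne']
    have : |(σ : ℝ)| ≤ 1 := by exact_mod_cast hσ
    exact mul_le_of_le_one_right (by positivity) this
  · simp only [Function.comp_apply]
    congr 1
    funext j
    -- Index `j` counts from zero and uses the prefix `[0, j + 1)`, which contains `t` iff `t ≤ j`.
    -- Since `σ` is an integer, the shift commutes with rounding.
    rw [prefixNoise_add, prefixNoise_leafShift (by omega) (by omega), ← add_assoc]
    by_cases h : t ≤ j.val
    · rw [if_pos (by omega), if_pos h, round_add_intCast]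
    · rw [if_neg (by omega), if_neg h, add_zero, add_zero]

/-! ### Tail bound for the prefix noise -/

theorem exp_mul_pow_le_of_le {lg y : ℝ} {k : ℕ} (hk : (k : ℝ) ≤ lg) (hy : 4 / 3 * lg ≤ y) :
    Real.exp (-y) * (9 / 5) ^ k ≤ 2 ^ (-lg) := by
  have hlg : 0 ≤ lg := (Nat.cast_nonneg k).trans hk
  have hlog : Real.log (9 / 5) + Real.log 2 ≤ 4 / 3 := by
    rw [← Real.log_mul (by norm_num) (by norm_num), Real.log_le_iff_le_exp (by norm_num)]
    -- After cubing, the claim is `(18/5)^3 ≤ e^4`.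
    refine le_of_pow_le_pow_left₀ (n := 3) (by norm_num) (Real.exp_pos _).le ?_
    rw [← Real.exp_nat_mul, show ((3 : ℕ) : ℝ) * (4 / 3) = (4 : ℕ) * 1 by norm_num,
      Real.exp_nat_mul]
    refine le_trans ?_ (pow_le_pow_left₀ (by norm_num) Real.exp_one_gt_d9.le 4)
    norm_num
  have hlog0 : 0 ≤ Real.log (9 / 5) := Real.log_nonneg (by norm_num)
  rw [Real.rpow_def_of_pos two_pos, ← Real.exp_log (show (0 : ℝ) < 9 / 5 by norm_num),
    ← Real.exp_nat_mul, ← Real.exp_add]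
  refine Real.exp_le_exp.2 ?_
  nlinarith [mul_le_mul_of_nonneg_right hk hlog0, mul_le_mul_of_nonneg_left hlog hlg]

/-- The variant for `m = 2`: the exponent is only `lg`, but a single node contributes a factor
`9/5`. The worst case `lg = 2` reduces to `36/5 ≤ e^2`. -/
theorem exp_mul_pow_le_of_two_le {lg : ℝ} {k : ℕ} (hk : k ≤ 1) (hlg : 2 ≤ lg) :
    Real.exp (-lg) * (9 / 5) ^ k ≤ 2 ^ (-lg) := by
  have hlog : Real.log (9 / 5) + 2 * Real.log 2 ≤ 2 := by
    rw [← Real.log_rpow two_pos, ← Real.log_mul (by norm_num) (by norm_num),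
      Real.log_le_iff_le_exp (by norm_num), show (2 : ℝ) = (2 : ℕ) * 1 by norm_num,
      Real.exp_nat_mul]
    refine le_trans ?_ (pow_le_pow_left₀ (by norm_num) Real.exp_one_gt_d9.le 2)
    norm_num
  have hlog1 : Real.log 2 ≤ 1 := by
    have := Real.log_le_sub_one_of_pos two_pos
    linarith
  have h1 : ((9 : ℝ) / 5) ^ k ≤ 9 / 5 := by
    calc ((9 : ℝ) / 5) ^ k ≤ (9 / 5) ^ 1 := pow_le_pow_right₀ (by norm_num) hk
      _ = 9 / 5 := pow_one _
  refine (mul_le_mul_of_nonneg_left h1 (Real.exp_pos _).le).trans ?_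
  rw [Real.rpow_def_of_pos two_pos, ← Real.exp_log (show (0 : ℝ) < 9 / 5 by norm_num),
    ← Real.exp_add]
  refine Real.exp_le_exp.2 ?_
  nlinarith

theorem levels_two : levels 2 = 2 := by
  rw [levels, Nat.ceil_eq_iff (by norm_num)]
  constructor
  · rw [Real.lt_logb_iff_rpow_lt one_lt_two (by norm_num)]; norm_num
  · rw [Real.logb_le_iff_le_rpow one_lt_two (by norm_num)]; norm_num

theorem levels_le_logb {m : ℕ} (hm : 1 ≤ m) : (levels m : ℝ) ≤ Real.logb 2 (2 * m) := by
  have hm' : (0 : ℝ) < m := by exact_mod_cast hm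
  rw [Real.le_logb_iff_rpow_le one_lt_two (by positivity), Real.rpow_natCast]
  exact_mod_cast two_pow_levels_le hm

/-- For `m ≥ 4` the bound `1 + log m` suffices because `log m ≥ 2`; for `m = 3` there are two levels
and `log 3 ≥ 4/3`. It fails for `m = 2`. -/
theorem levels_le_mul_logb {m : ℕ} (hm : 3 ≤ m) : (levels m : ℝ) ≤ 3 / 2 * Real.logb 2 m := by
  have hm' : (0 : ℝ) < m := by positivity
  rcases hm.eq_or_lt with rfl | hm4
  · have h1 : levels 3 ≤ 2 := by
      refine Nat.ceil_le.2 ?_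
      rw [Real.logb_le_iff_le_rpow one_lt_two (by norm_num)]; norm_num
    have h2 : (4 / 3 : ℝ) ≤ Real.logb 2 (3 : ℕ) := by
      rw [Real.le_logb_iff_rpow_le one_lt_two (by norm_num)]
      refine le_of_pow_le_pow_left₀ (n := 3) (by norm_num) (by norm_num) ?_
      rw [← Real.rpow_natCast, ← Real.rpow_mul (by norm_num)]
      norm_num
    have h1' : (levels 3 : ℝ) ≤ 2 := by exact_mod_cast h1
    linarith
  · have h1 := levels_le_logb (m := m) (by omega)
    rw [Real.logb_mul (by norm_num) hm'.ne', Real.logb_self_eq_one one_lt_two] at h1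
    have h2 : (2 : ℝ) ≤ Real.logb 2 m := by
      rw [Real.le_logb_iff_rpow_le one_lt_two hm']
      have : (4 : ℝ) ≤ m := by exact_mod_cast hm4
      norm_num
      linarith
    linarith

theorem pi_laplace_prefixNoise_le {m : ℕ} (hm : 2 ≤ m) {ε δ : ℝ} (hε : 0 < ε) (hδ : 0 < δ)
    (hδ1 : δ < 1) (i : Fin m) :
    Measure.pi (fun _ : Node m => laplace (levels m / ε))
      {η | noiseBound m ε δ < |prefixNoise η (i.val + 1)|} ≤ ENNReal.ofReal (δ / m) := by
  have hs := scale_pos (m := m) (by omega) hε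
  have hm' : (2 : ℝ) ≤ m := by exact_mod_cast hm
  have hT : (0 : ℝ) < levels m := by exact_mod_cast levels_pos (m := m) (by omega)
  set s : ℝ := levels m / ε with hs_def
  -- With this Chernoff parameter each node contributes the factor `1 / (1 - 4/9) = 9/5`, and `t w =
  -- 2 (log m / T) lg`.
  set t : ℝ := 2 / 3 / s with ht_def
  have hts : t * s = 2 / 3 := by rw [ht_def]; field_simp
  have h := pi_laplace_abs_gt_le hs (t := t) (by positivity) (by rw [hts]; norm_num)
    (prefixNodes m (i.val + 1)) (noiseBound m ε δ)
  simp only [prefixNoise_eq_sum]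
  refine h.trans (ENNReal.ofReal_le_ofReal ?_)
  set lg := Real.logb 2 (2 * m / δ) with hlg
  have hlgm : Real.logb 2 (2 * m) ≤ lg := by
    refine Real.logb_le_logb_of_le one_lt_two (by positivity) ?_
    rw [le_div_iff₀ hδ]
    nlinarith
  have hlgpos : 2 ≤ lg := by
    refine le_trans ?_ hlgm
    rw [Real.le_logb_iff_rpow_le one_lt_two (by positivity)]
    norm_num
    linarith
  have h2 : (2 : ℝ) ^ (-lg) = δ / (2 * m) := by
    rw [Real.rpow_neg two_pos.le, hlg, Real.rpow_logb two_pos (by norm_num) (by positivity),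
      inv_div]
  have hy : t * noiseBound m ε δ = 2 * (Real.logb 2 m / levels m) * lg := by
    rw [ht_def, hs_def, noiseBound, ← hlg]
    field_simp
  rw [hts, show (1 : ℝ) / (1 - (2 / 3) ^ 2) = 9 / 5 by norm_num,
    show δ / m = 2 * (δ / (2 * m)) by field_simp, ← h2]
  refine mul_le_mul_of_nonneg_left ?_ two_pos.le
  -- For `m = 2` the Chernoff exponent is exactly `lg`; for `m ≥ 3` it is at least `4/3 lg`, which
  -- absorbs up to `T ≤ lg` factors `9/5`.
  rcases hm.eq_or_lt with rfl | hm3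
  · have : t * noiseBound 2 ε δ = lg := by
      rw [hy, levels_two]
      norm_num
    rw [this]
    refine exp_mul_pow_le_of_two_le ?_ hlgpos
    have hi : i.val + 1 = 2 ^ i.val := by
      have := i.isLt
      interval_cases i.val <;> rfl
    rw [hi]
    exact card_prefixNodes_two_pow _ _
  · refine exp_mul_pow_le_of_le ?_ ?_
    · refine le_trans ?_ ((levels_le_logb (by omega)).trans hlgm)
      exact_mod_cast card_prefixNodes_le m (i.val + 1)
    · rw [hy]
      refine mul_le_mul_of_nonneg_right ?_ (by linarith)
      have := levels_le_mul_logb (m := m) (by omega)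
      have : 2 / 3 ≤ Real.logb 2 m / levels m := by
        rw [le_div_iff₀ hT]; linarith
      linarith

/-- The noisy ranks which are within `w + 1 / 2` of `r`. -/
def closeRanks {m : ℕ} (r : Fin m → ℤ) (w : ℝ) : Set (Fin m → ℤ) :=
  {v | ∀ j, |(v j : ℝ) - r j| ≤ w + 1 / 2}

/-- Union bound over the `m` prefixes, each failing with probability at most `δ / m`; rounding
accounts for the `1/2` in `closeRanks`. -/
theorem continualCounting_compl_closeRanks_le {m : ℕ} (hm : 2 ≤ m) {ε δ : ℝ} (hε : 0 < ε)
    (hδ : 0 < δ) (hδ1 : δ < 1) (r : Fin m → ℤ) :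
    continualCounting m ε r (closeRanks r (noiseBound m ε δ))ᶜ ≤ ENNReal.ofReal δ := by
  have hm' : (0 : ℝ) < m := by positivity
  rw [continualCounting, Measure.map_apply (measurable_noisyRanks r) MeasurableSet.of_discrete]
  calc _ ≤ Measure.pi (fun _ : Node m => laplace (levels m / ε))
        (⋃ i : Fin m, {η | noiseBound m ε δ < |prefixNoise η (i.val + 1)|}) := by
        refine measure_mono fun η hη => ?_
        simp only [closeRanks, mem_preimage, mem_compl_iff, mem_ofPred_eq, not_forall, not_le] at hη
        obtain ⟨j, hj⟩ := hη
        refine mem_iUnion.2 ⟨j, ?_⟩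
        have h1 := abs_sub_round ((r j : ℝ) + prefixNoise η (j.val + 1))
        rw [mem_ofPred_eq]
        by_contra hc
        rw [not_lt, abs_le] at hc
        rw [abs_le] at h1
        refine absurd hj (not_lt.2 ?_)
        rw [abs_le]
        constructor <;> linarith [h1.1, h1.2, hc.1, hc.2]
    _ ≤ ∑ i : Fin m, ENNReal.ofReal (δ / m) :=
        (measure_iUnion_fintype_le _ _).trans
          (Finset.sum_le_sum fun i _ => pi_laplace_prefixNoise_le hm hε hδ hδ1 i)
    _ = ENNReal.ofReal δ := by
        rw [Finset.sum_const, Finset.card_univ, Fintype.card_fin, nsmul_eq_mul,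
          ← ENNReal.ofReal_natCast, ← ENNReal.ofReal_mul (by positivity)]
        congr 1
        field_simp

end SliceQuantiles

namespace SliceQuantiles

/-! ### The exponential mechanism -/

/-- The unnormalised law of `singleQuantile`. -/
noncomputable def quantileWeight (t : ℕ) (ε : ℝ) (S : Dataset) (a b : ℝ) : Measure ℝ :=
  (volume.restrict (Ioo a b)).withDensity
    (fun z => ENNReal.ofReal (Real.exp (ε / 2 * (-|(rank S z : ℝ) - (t : ℝ)|))))

theorem singleQuantile_eq (t : ℕ) (ε : ℝ) (S : Dataset) (a b : ℝ) :
    singleQuantile t ε S a b = (quantileWeight t ε S a b univ)⁻¹ • quantileWeight t ε S a b := rfl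

theorem measurable_weight (t : ℕ) (ε : ℝ) (S : Dataset) : Measurable fun z : ℝ =>
    ENNReal.ofReal (Real.exp (ε / 2 * (-|(rank S z : ℝ) - (t : ℝ)|))) := by
  have : Measurable fun z : ℝ => (rank S z : ℝ) := measurable_from_nat.comp (measurable_rank S)
  fun_prop

/-- Only an inequality: an empty range `(a, b)` gives the zero measure. -/
theorem singleQuantile_univ_le_one (t : ℕ) (ε : ℝ) (S : Dataset) (a b : ℝ) :
    singleQuantile t ε S a b univ ≤ 1 := by
  rw [singleQuantile_eq, Measure.smul_apply, smul_eq_mul]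
  exact ENNReal.inv_mul_le_one _

theorem quantileWeight_le {t : ℕ} {ε : ℝ} (hε : 0 ≤ ε) {S S' : Dataset}
    (h : ∀ z, |(rank S z : ℝ) - rank S' z| ≤ 1) (a b : ℝ) :
    quantileWeight t ε S a b ≤
      ENNReal.ofReal (Real.exp (ε / 2)) • quantileWeight t ε S' a b := by
  rw [quantileWeight, quantileWeight, ← withDensity_smul _ (measurable_weight t ε S')]
  refine withDensity_mono (ae_of_all _ fun z => ?_)
  simp only [Pi.smul_apply, smul_eq_mul]
  rw [← ENNReal.ofReal_mul (by positivity), ← Real.exp_add]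
  refine ENNReal.ofReal_le_ofReal (Real.exp_le_exp.2 ?_)
  have h1 := abs_sub_abs_le_abs_sub ((rank S' z : ℝ) - t) ((rank S z : ℝ) - t)
  have h2 := h z
  rw [sub_sub_sub_cancel_right, abs_sub_comm (rank S' z : ℝ) (rank S z : ℝ)] at h1
  nlinarith

/-- The utility has sensitivity one, so the density and the normalising constant each cost a factor
`exp (ε / 2)`. -/
theorem singleQuantile_le {t : ℕ} {ε : ℝ} (hε : 0 ≤ ε) {S S' : Dataset}
    (h : ∀ z, |(rank S z : ℝ) - rank S' z| ≤ 1) (a b : ℝ) :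
    singleQuantile t ε S a b ≤ ENNReal.ofReal (Real.exp ε) • singleQuantile t ε S' a b := by
  set e := ENNReal.ofReal (Real.exp (ε / 2)) with he
  have he0 : e ≠ 0 := by simpa [he] using Real.exp_pos (ε / 2)
  have het : e ≠ ∞ := ENNReal.ofReal_ne_top
  have hee : ENNReal.ofReal (Real.exp ε) = e * e := by
    rw [he, ← ENNReal.ofReal_mul (by positivity), ← Real.exp_add, add_halves]
  have h1 := quantileWeight_le (t := t) hε h a b
  have h2 := quantileWeight_le (t := t) hε (S := S') (S' := S)
    (fun z => by rw [abs_sub_comm]; exact h z) a b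
  have h3 : (quantileWeight t ε S a b univ)⁻¹ ≤ e * (quantileWeight t ε S' a b univ)⁻¹ := by
    have := ENNReal.inv_le_inv.2 (h2 univ)
    rw [Measure.smul_apply, smul_eq_mul, ENNReal.mul_inv (Or.inl he0) (Or.inl het)] at this
    calc _ = e * (e⁻¹ * (quantileWeight t ε S a b univ)⁻¹) := by
          rw [← mul_assoc, ENNReal.mul_inv_cancel he0 het, one_mul]
      _ ≤ _ := mul_le_mul_right this e
  rw [singleQuantile_eq, singleQuantile_eq, hee]
  refine Measure.le_iff.2 fun A _ => ?_
  simp only [Measure.smul_apply, smul_eq_mul]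
  refine (mul_le_mul' h3 (h1 A)).trans_eq ?_
  rw [Measure.smul_apply, smul_eq_mul]
  ring

/-- If the slice lies in the clipped range and its middle gap has length at least one, then the
exponential mechanism returns a point of the range of the slice, except with probability
`b exp (-ε h / 2)`. -/
theorem le_singleQuantile_Ioc {X : Dataset} {b : ℝ} (hm : Monotone (orderStat X b)) {h : ℕ}
    (h1 : 1 ≤ h) {r : ℤ} (hgap : 1 ≤ orderStat X b r - orderStat X b (r - 1)) {ε : ℝ} (hε : 0 ≤ ε)
    {a' b' η : ℝ} (ha0 : 0 ≤ a') (hb' : b' ≤ b) (ha : a' ≤ orderStat X b (r - h))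
    (hb : orderStat X b (r + h) ≤ b') (hη0 : 0 ≤ η)
    (hη : b * Real.exp (-(ε * h / 2)) ≤ η) :
    ENNReal.ofReal (1 - η) ≤ singleQuantile ((slice X b h r).card / 2) ε (slice X b h r) a' b'
      (Ioc (orderStat X b (r - h)) (orderStat X b (r + h))) := by
  have hcard : (slice X b h r).card / 2 = h := by rw [card_slice]; omega
  rw [hcard, singleQuantile_eq, Measure.smul_apply, smul_eq_mul]
  set W := quantileWeight h ε (slice X b h r) a' b' with hW
  set G := Ioc (orderStat X b (r - h)) (orderStat X b (r + h))
  have hlo : a' ≤ orderStat X b (r - 1) := ha.trans (hm (by omega))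
  have hhi : orderStat X b r ≤ b' := (hm (by omega)).trans hb
  -- Between `x_(r-1)` and `x_(r)` exactly `h` slice points lie below `z`; this is the target rank,
  -- so the density there is `1`.
  have hW1 : 1 ≤ W univ := by
    calc (1 : ℝ≥0∞) ≤ volume (Ioo (orderStat X b (r - 1)) (orderStat X b r)) := by
          rw [Real.volume_Ioo, ← ENNReal.ofReal_one]
          exact ENNReal.ofReal_le_ofReal hgap
      _ = W (Ioo (orderStat X b (r - 1)) (orderStat X b r)) := by
          rw [hW, quantileWeight, withDensity_apply _ measurableSet_Ioo,
            Measure.restrict_restrict measurableSet_Ioo,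
            inter_eq_left.2 (Ioo_subset_Ioo hlo hhi)]
          rw [setLIntegral_congr_fun (g := fun _ => 1) measurableSet_Ioo, setLIntegral_one]
          intro z hz
          simp only
          rw [rank_slice_eq_half hm hz.1 hz.2.le]
          simp
      _ ≤ W univ := measure_mono (subset_univ _)
  have hWG : W Gᶜ ≤ ENNReal.ofReal η := by
    have hG : MeasurableSet Gᶜ := measurableSet_Ioc.compl
    rw [hW, quantileWeight, withDensity_apply _ hG]
    calc _ ≤ ∫⁻ _ in Gᶜ, ENNReal.ofReal (Real.exp (-(ε * h / 2)))
            ∂volume.restrict (Ioo a' b') := by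
          refine setLIntegral_mono' hG fun z hz => ?_
          refine ENNReal.ofReal_le_ofReal (Real.exp_le_exp.2 ?_)
          -- Outside the slice the rank is `0` or `2h + 1`, hence at least `h` away from the target.
          have : (h : ℝ) ≤ |(rank (slice X b h r) z : ℝ) - h| := by
            rcases le_or_gt z (orderStat X b (r - h)) with hz1 | hz1
            · rw [rank_slice_eq_zero hm hz1]
              simp
            · have hz2 : orderStat X b (r + h) < z := by
                by_contra hc
                exact hz ⟨hz1, not_lt.1 hc⟩
              rw [rank_slice_eq_card hm hz2]
              refine le_trans ?_ (le_abs_self _)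
              push_cast
              linarith
          nlinarith
      _ ≤ ENNReal.ofReal (Real.exp (-(ε * h / 2))) * ENNReal.ofReal b := by
          rw [setLIntegral_const]
          refine mul_le_mul_right ?_ _
          refine (measure_mono (subset_univ _)).trans ?_
          rw [Measure.restrict_apply_univ, Real.volume_Ioo]
          exact ENNReal.ofReal_le_ofReal (by linarith)
      _ ≤ ENNReal.ofReal η := by
          rw [← ENNReal.ofReal_mul (by positivity), mul_comm]
          exact ENNReal.ofReal_le_ofReal hη
  have hWtop : W univ ≠ ∞ := by
    rw [hW, quantileWeight, withDensity_apply _ MeasurableSet.univ, Measure.restrict_univ]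
    refine ne_of_lt (lt_of_le_of_lt (lintegral_mono (g := fun _ => 1) fun z => ?_) ?_)
    · rw [← ENNReal.ofReal_one]
      refine ENNReal.ofReal_le_ofReal (Real.exp_le_one_iff.2 ?_)
      nlinarith [abs_nonneg ((rank (slice X b h r) z : ℝ) - h)]
    · simp
  have hsum : 1 ≤ (W univ)⁻¹ * W G + ENNReal.ofReal η := by
    calc (1 : ℝ≥0∞) = (W univ)⁻¹ * W univ :=
          (ENNReal.inv_mul_cancel (one_pos.trans_le hW1).ne' hWtop).symm
      _ = (W univ)⁻¹ * W G + (W univ)⁻¹ * W Gᶜ := by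
          rw [← measure_add_measure_compl (μ := W) measurableSet_Ioc, mul_add]
      _ ≤ (W univ)⁻¹ * W G + 1 * ENNReal.ofReal η := by
          gcongr
          exact ENNReal.inv_le_one.2 hW1
      _ = _ := by rw [one_mul]
  rw [ENNReal.ofReal_sub _ hη0, ENNReal.ofReal_one]
  exact tsub_le_iff_right.2 hsum

/-! ### The main loop -/

/-- The rounds are composed with `Measure.bind`, which needs measurability in the earlier estimates.
Moving the endpoints into a measurable subset of the product reduces it to Tonelli. -/
theorem measurable_quantileWeight_apply {α : Type*} [MeasurableSpace α] (t : ℕ) (ε : ℝ)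
    (S : Dataset) {a b : α → ℝ} (ha : Measurable a) (hb : Measurable b) {A : Set (α × ℝ)}
    (hA : MeasurableSet A) :
    Measurable fun y => quantileWeight t ε S (a y) (b y) (Prod.mk y ⁻¹' A) := by
  set B : Set (α × ℝ) := ({p | a p.1 < p.2} ∩ {p | p.2 < b p.1}) ∩ A with hBdef
  have hB : MeasurableSet B :=
    ((measurableSet_lt (ha.comp measurable_fst) measurable_snd).inter
      (measurableSet_lt measurable_snd (hb.comp measurable_fst))).inter hA
  have h := (((measurable_weight t ε S).comp measurable_snd).indicator hB).lintegral_prod_right'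
    (ν := (volume : Measure ℝ))
  convert h using 2 with y
  rw [quantileWeight, withDensity_apply _ (measurable_prodMk_left hA),
    Measure.restrict_restrict (measurable_prodMk_left hA),
    ← lintegral_indicator ((measurable_prodMk_left hA).inter measurableSet_Ioo)]
  congr 1 with v
  have : v ∈ Prod.mk y ⁻¹' A ∩ Ioo (a y) (b y) ↔ (y, v) ∈ B := by
    simp only [hBdef, mem_inter_iff, mem_preimage, mem_Ioo, mem_ofPred_eq]
    tauto
  by_cases hv : (y, v) ∈ B
  · rw [indicator_of_mem hv, indicator_of_mem (this.2 hv)]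
    rfl
  · rw [indicator_of_notMem hv, indicator_of_notMem (mt this.1 hv)]

theorem measurable_singleQuantile_map_update {m : ℕ} (t : ℕ) (ε : ℝ) (S : Dataset) (j : Fin m)
    {a b : (Fin m → ℝ) → ℝ} (ha : Measurable a) (hb : Measurable b) :
    Measurable fun z => (singleQuantile t ε S (a z) (b z)).map
      (fun v => Function.update z j v) := by
  have hu : Measurable fun p : (Fin m → ℝ) × ℝ => Function.update p.1 j p.2 := by
    refine measurable_pi_lambda _ fun i => ?_
    by_cases hi : i = j
    · subst hi; simpa using measurable_snd
    · simp only [Function.update_of_ne hi]; fun_prop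
  refine Measure.measurable_of_measurable_coe _ fun A hA => ?_
  have : ∀ z, (singleQuantile t ε S (a z) (b z)).map (fun v => Function.update z j v) A =
      (quantileWeight t ε S (a z) (b z) (Prod.mk z ⁻¹' univ))⁻¹ *
        quantileWeight t ε S (a z) (b z)
          (Prod.mk z ⁻¹' ((fun p : (Fin m → ℝ) × ℝ => Function.update p.1 j p.2) ⁻¹' A)) := by
    intro z
    rw [Measure.map_apply (measurable_update z) hA, singleQuantile_eq, Measure.smul_apply,
      smul_eq_mul]
    rfl
  simp only [this]
  exact (measurable_quantileWeight_apply t ε S ha hb MeasurableSet.univ).inv.mul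
    (measurable_quantileWeight_apply t ε S ha hb (hu hA))

theorem measurable_fold {m : ℕ} (op : ℝ → ℝ → ℝ) [Std.Commutative op] [Std.Associative op]
    (hop : Measurable fun p : ℝ × ℝ => op p.1 p.2) (c : ℝ) (s : Finset (Fin m)) :
    Measurable fun z : Fin m → ℝ => s.fold op c z := by
  induction s using Finset.cons_induction with
  | empty => simp
  | cons i s hi ih =>
    simp only [Finset.fold_cons]
    exact hop.comp ((measurable_pi_apply i).prodMk ih)

/-- The law of the estimates after a round, given those before it. -/
noncomputable def loopKernel {m : ℕ} (b : ℝ) (h : ℕ) (ε₂ : ℝ) (π : Equiv.Perm (Fin m))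
    (X : Dataset) (r : Fin m → ℤ) (k : ℕ) (j : Fin m) (z : Fin m → ℝ) : Measure (Fin m → ℝ) :=
  (singleQuantile ((slice X b h (r j)).card / 2) ε₂ (slice X b h (r j)) (clipLower π k j z)
    (clipUpper b π k j z)).map (fun v => Function.update z j v)

section Loop

variable {m : ℕ} {b : ℝ} {h : ℕ} {ε₂ : ℝ} {π : Equiv.Perm (Fin m)} {X X' : Dataset}
  {r r' : Fin m → ℤ}

theorem loop_succ {k : ℕ} (hk : k < m) : loop b h ε₂ π X r (k + 1) =
    (loop b h ε₂ π X r k).bind (loopKernel b h ε₂ π X r k (π ⟨k, hk⟩)) := by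
  rw [loop, dif_pos hk]
  rfl

theorem measurable_loopKernel (k : ℕ) (j : Fin m) :
    Measurable (loopKernel b h ε₂ π X r k j) :=
  measurable_singleQuantile_map_update _ _ _ _ (measurable_fold max (by fun_prop) _ _)
    (measurable_fold min (by fun_prop) _ _)

theorem loop_univ_le_one {k : ℕ} (hk : k ≤ m) : loop b h ε₂ π X r k univ ≤ 1 := by
  induction k with
  | zero => simp [loop]
  | succ k ih =>
    rw [loop_succ hk]
    refine (Measure.bind_apply_le _ MeasurableSet.univ).trans ?_
    refine (lintegral_mono (g := fun _ => 1) fun z => ?_).trans ?_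
    · rw [loopKernel, Measure.map_apply (measurable_update z) MeasurableSet.univ]
      exact singleQuantile_univ_le_one _ _ _ _ _
    · simpa using ih (by omega)

/-- Adaptive composition: earlier estimates enter a round only through the clipped range, and the
hypothesis is uniform in that range, so the factors multiply. -/
theorem loop_le_prod_smul (c : Fin m → ℝ≥0∞)
    (hc : ∀ j a a', singleQuantile ((slice X b h (r j)).card / 2) ε₂ (slice X b h (r j)) a a' ≤
      c j • singleQuantile ((slice X' b h (r' j)).card / 2) ε₂ (slice X' b h (r' j)) a a')
    {k : ℕ} (hk : k ≤ m) :
    loop b h ε₂ π X r k ≤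
      (∏ i with i.val < k, c (π i)) • loop b h ε₂ π X' r' k := by
  induction k with
  | zero => simp [loop]
  | succ k ih =>
    have hins : (Finset.univ.filter fun i : Fin m => i.val < k + 1) =
        insert ⟨k, hk⟩ (Finset.univ.filter fun i : Fin m => i.val < k) := by
      ext i
      simp only [Finset.mem_filter, Finset.mem_univ, true_and, Finset.mem_insert, Fin.ext_iff]
      omega
    rw [hins, Finset.prod_insert (by simp), loop_succ hk, loop_succ hk]
    refine Measure.le_iff.2 fun A hA => ?_
    rw [Measure.smul_apply, smul_eq_mul, Measure.bind_apply hA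
      (measurable_loopKernel _ _).aemeasurable, Measure.bind_apply hA
      (measurable_loopKernel _ _).aemeasurable]
    refine (lintegral_mono' (ih (by omega))
      (g := fun z => c (π ⟨k, hk⟩) * loopKernel b h ε₂ π X' r' k (π ⟨k, hk⟩) z A) fun z => ?_).trans ?_
    · simp only [loopKernel]
      rw [Measure.map_apply (measurable_update z) hA, Measure.map_apply (measurable_update z) hA]
      exact hc _ _ _ _
    · have hmeas : Measurable fun z => loopKernel b h ε₂ π X' r' k (π ⟨k, hk⟩) z A :=
        (Measure.measurable_coe hA).comp (measurable_loopKernel _ _)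
      rw [lintegral_smul_measure, lintegral_const_mul _ hmeas, smul_eq_mul]
      exact le_of_eq (by ring)

/-- Changing at most one slice, and its ranks by at most one, changes the law of the loop by a
factor `exp ε₂`. -/
theorem loop_le_smul (hε₂ : 0 ≤ ε₂) {B : Set (Fin m)} (hB : B.Subsingleton)
    (hout : ∀ j ∉ B, slice X b h (r j) = slice X' b h (r' j))
    (hin : ∀ j ∈ B, ∀ z,
      |(rank (slice X b h (r j)) z : ℝ) - rank (slice X' b h (r' j)) z| ≤ 1) :
    loop b h ε₂ π X r m ≤ ENNReal.ofReal (Real.exp ε₂) • loop b h ε₂ π X' r' m := by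
  classical
  have he : 1 ≤ ENNReal.ofReal (Real.exp ε₂) := by
    rw [← ENNReal.ofReal_one]
    exact ENNReal.ofReal_le_ofReal (Real.one_le_exp hε₂)
  have hmain := loop_le_prod_smul (π := π) (X := X) (X' := X') (r := r) (r' := r') (b := b)
    (h := h) (ε₂ := ε₂) (fun j => if j ∈ B then ENNReal.ofReal (Real.exp ε₂) else 1)
    (fun j a a' => by
      by_cases hj : j ∈ B
      · rw [if_pos hj, card_slice, card_slice]
        exact singleQuantile_le hε₂ (hin j hj) a a'
      · rw [if_neg hj, hout j hj, one_smul]) le_rfl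
  refine hmain.trans ?_
  have huniv : (Finset.univ.filter fun i : Fin m => i.val < m) = Finset.univ :=
    Finset.filter_true_of_mem fun i _ => i.isLt
  rw [huniv, Equiv.prod_comp π (fun j => if j ∈ B then ENNReal.ofReal (Real.exp ε₂) else 1),
    Finset.prod_ite, Finset.prod_const, Finset.prod_const_one, mul_one]
  have hcard : (Finset.univ.filter fun j => j ∈ B).card ≤ 1 :=
    Finset.card_le_one.2 fun i hi j hj => hB (Finset.mem_filter.1 hi).2 (Finset.mem_filter.1 hj).2
  refine Measure.le_iff.2 fun A _ => mul_le_mul_left ?_ _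
  exact (pow_le_pow_right₀ he hcard).trans_eq (pow_one _)

/-- The first `k` estimates lie in the ranges of their slices. -/
def inSlices (b : ℝ) (h : ℕ) (π : Equiv.Perm (Fin m)) (X : Dataset) (r : Fin m → ℤ) (k : ℕ) :
    Set (Fin m → ℝ) :=
  {z | ∀ i, (π.symm i).val < k → z i ∈ Ioc (orderStat X b (r i - h)) (orderStat X b (r i + h))}

theorem measurableSet_inSlices (k : ℕ) : MeasurableSet (inSlices b h π X r k) := by
  have : inSlices b h π X r k = ⋂ i, {z | (π.symm i).val < k →
      z i ∈ Ioc (orderStat X b (r i - h)) (orderStat X b (r i + h))} := by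
    ext z; simp [inSlices]
  rw [this]
  refine MeasurableSet.iInter fun i => ?_
  by_cases hi : (π.symm i).val < k
  · simp only [hi, true_imp_iff]
    exact measurableSet_Ioc.preimage (measurable_pi_apply i)
  · simp [hi]

/-- Induction over the rounds: estimates inside their own slices leave the range of the next slice
unclipped, so every round succeeds with conditional probability at least `1 - η`. -/
theorem le_loop_inSlices (hb : 0 ≤ b) (hX : ∀ x ∈ X, x ∈ Icc 0 b) (hgap : HasUnitGap X)
    (h1 : 1 ≤ h) (hε₂ : 0 ≤ ε₂) (hlow : ∀ j, (h : ℤ) + 1 ≤ r j)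
    (hup : ∀ j, r j + h ≤ X.card) (hsep : ∀ i j, i < j → r i + 2 * h ≤ r j) {η : ℝ} (hη0 : 0 ≤ η)
    (hη1 : η ≤ 1) (hη : b * Real.exp (-(ε₂ * h / 2)) ≤ η) {k : ℕ} (hk : k ≤ m) :
    ENNReal.ofReal ((1 - η) ^ k) ≤ loop b h ε₂ π X r k (inSlices b h π X r k) := by
  have hmono := orderStat_mono hb hX
  induction k with
  | zero =>
    have : inSlices b h π X r 0 = univ := by ext; simp [inSlices]
    simp [this, loop]
  | succ k ih =>
    set j := π ⟨k, hk⟩ with hj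
    have hjk : ∀ i, (π.symm i).val < k + 1 → i ≠ j → (π.symm i).val < k := by
      intro i hi hij
      have : (π.symm i).val ≠ k := fun hc => hij (by
        rw [hj, ← Equiv.symm_apply_eq]
        exact Fin.ext hc)
      omega
    rw [loop_succ hk, Measure.bind_apply (measurableSet_inSlices _)
      (measurable_loopKernel _ _).aemeasurable, pow_succ', ENNReal.ofReal_mul (by linarith)]
    calc _ ≤ ENNReal.ofReal (1 - η) * loop b h ε₂ π X r k (inSlices b h π X r k) :=
          mul_le_mul_right (ih (by omega)) _
      _ = ∫⁻ _ in inSlices b h π X r k, ENNReal.ofReal (1 - η) ∂loop b h ε₂ π X r k := by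
          rw [setLIntegral_const]
      _ ≤ ∫⁻ z in inSlices b h π X r k,
            loopKernel b h ε₂ π X r k j z (inSlices b h π X r (k + 1)) ∂loop b h ε₂ π X r k := by
          refine setLIntegral_mono' (measurableSet_inSlices k) fun z hz => ?_
          rw [loopKernel, Measure.map_apply (measurable_update z) (measurableSet_inSlices _)]
          have hg : 1 ≤ orderStat X b (r j) - orderStat X b (r j - 1) := by
            have h2 := hlow j
            have h3 := hup j
            have := one_le_orderStat_sub (b := b) hgap (k := r j - 1) (by omega) (by omega)
            rwa [sub_add_cancel] at this
          refine (le_singleQuantile_Ioc hmono h1 hg hε₂ ?_ ?_ ?_ ?_ hη0 hη).trans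
            (measure_mono fun v hv => ?_)
          · exact (Finset.le_fold_max _).2 (Or.inl le_rfl)
          · exact (Finset.fold_min_le _).2 (Or.inl le_rfl)
          -- An estimate with `i < j` is at most `x_(r_i + h)`, and `r_i + h ≤ r_j - h`; the upper
          -- end is symmetric.
          · refine (Finset.fold_max_le _).2 ⟨(orderStat_mem_Icc hb hX _).1, fun i hi => ?_⟩
            obtain ⟨hi1, hi2⟩ := (Finset.mem_filter.1 hi).2
            have := hsep i j hi2
            exact (hz i hi1).2.trans (hmono (by omega))
          · refine (Finset.le_fold_min _).2 ⟨(orderStat_mem_Icc hb hX _).2, fun i hi => ?_⟩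
            obtain ⟨hi1, hi2⟩ := (Finset.mem_filter.1 hi).2
            have := hsep j i hi2
            exact (hmono (by omega)).trans (hz i hi1).1.le
          · intro i hi
            by_cases hij : i = j
            · subst hij; simpa using hv
            · rw [Function.update_of_ne hij]
              exact hz i (hjk i hi hij)
      _ ≤ _ := setLIntegral_le_lintegral _ _

end Loop

end SliceQuantiles

namespace SliceQuantiles

/-! ### Good rank vectors -/

theorem Good.add_le {m n : ℕ} {H : ℝ} {r : Fin m → ℤ} (hr : r ∈ Good m n H) (hH : 0 ≤ H)
    {i j : Fin m} (hij : i < j) : (r i : ℝ) + 2 * H ≤ r j := by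
  obtain ⟨i, hi⟩ := i
  obtain ⟨j, hj⟩ := j
  rw [Fin.lt_def] at hij
  simp only at hij
  induction j, hij using Nat.le_induction with
  | base => exact hr.2.1 ⟨i, hi⟩ ⟨i + 1, hj⟩ rfl
  | succ j hij ih =>
    have h1 := ih (by omega)
    have h2 := hr.2.1 ⟨j, by omega⟩ ⟨j + 1, hj⟩ rfl
    linarith

theorem Good.le_apply {m n : ℕ} {H : ℝ} {r : Fin m → ℤ} (hr : r ∈ Good m n H) (hH : 0 ≤ H)
    (j : Fin m) : H ≤ r j := by
  have hm : 0 < m := by have := j.isLt; omega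
  have h1 := hr.1 ⟨0, hm⟩ rfl
  by_cases hj : j.val = 0
  · exact hr.1 j hj
  · have := Good.add_le hr hH (i := ⟨0, hm⟩) (j := j) (Fin.lt_def.2 (Nat.pos_of_ne_zero hj))
    linarith

theorem Good.apply_le {m n : ℕ} {H : ℝ} {r : Fin m → ℤ} (hr : r ∈ Good m n H) (hH : 0 ≤ H)
    (j : Fin m) : (r j : ℝ) ≤ n - H := by
  have hm : 0 < m := by have := j.isLt; omega
  have h1 := hr.2.2 ⟨m - 1, by omega⟩ (by simp; omega)
  by_cases hj : j.val + 1 = m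
  · exact hr.2.2 j hj
  · have hlt : j < ⟨m - 1, by omega⟩ := Fin.lt_def.2 (by simp only; omega)
    have := Good.add_le hr hH hlt
    linarith

/-- Noisy ranks close to well separated ranks stay good after a shift. -/
theorem add_mem_good {m n n' h : ℕ} {w : ℝ} {r v s : Fin m → ℤ}
    (hr : r ∈ Good m n (w + h + 1)) (hv : v ∈ closeRanks r w) (hs : ∀ j, -1 ≤ s j)
    (hs' : ∀ j, s j ≤ n' - n) (hss : ∀ i j, s i - s j ≤ 1) :
    (fun j => v j + s j) ∈ Good m n' h := by
  refine ⟨fun i hi => ?_, fun i j hij => ?_, fun i hi => ?_⟩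
  · have h1 := hr.1 i hi
    have h2 := abs_le.1 (hv i)
    have h3 : ((-1 : ℤ) : ℝ) ≤ s i := by exact_mod_cast hs i
    -- Rounding and shift may cost `3/2`, more than the slack `1`; since both sides are integers,
    -- exceeding `h - 1` is enough.
    have h4 : ((h : ℤ) : ℝ) - 1 < ((v i + s i : ℤ) : ℝ) := by push_cast at h3 ⊢; linarith
    have h5 : ((h : ℤ) - 1 : ℤ) < v i + s i := by exact_mod_cast h4
    have h6 : (h : ℤ) ≤ v i + s i := by omega
    exact_mod_cast h6
  · have h1 := hr.2.1 i j hij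
    have h2 := abs_le.1 (hv i)
    have h3 := abs_le.1 (hv j)
    have h4 : ((s i - s j : ℤ) : ℝ) ≤ ((1 : ℤ) : ℝ) := by exact_mod_cast hss i j
    push_cast at h4 ⊢
    linarith
  · have h1 := hr.2.2 i hi
    have h2 := abs_le.1 (hv i)
    have h3 : ((s i : ℤ) : ℝ) ≤ ((n' - n : ℤ) : ℝ) := by exact_mod_cast hs' i
    push_cast at h3 ⊢
    linarith

theorem noiseBound_nonneg {m : ℕ} (hm : 1 ≤ m) {ε δ : ℝ} (hε : 0 < ε) (hδ : 0 < δ) (hδ1 : δ < 1) :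
    0 ≤ noiseBound m ε δ := by
  have hm' : (1 : ℝ) ≤ m := by exact_mod_cast hm
  have h1 : 0 ≤ Real.logb 2 (m : ℝ) := Real.logb_nonneg one_lt_two hm'
  have h2 : 0 ≤ Real.logb 2 (2 * m / δ) := by
    refine Real.logb_nonneg one_lt_two ?_
    rw [le_div_iff₀ hδ]
    linarith
  exact div_nonneg (by positivity) hε.le

/-! ### The mechanism -/

theorem isProbabilityMeasure_uniformOutput (m : ℕ) {b : ℝ} (hb : 0 < b) :
    IsProbabilityMeasure (uniformOutput m b) := by
  have : IsProbabilityMeasure (ProbabilityTheory.cond (volume : Measure ℝ) (Ioo 0 b)) :=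
    ProbabilityTheory.cond_isProbabilityMeasure_of_finite (by simp [hb]) (by simp)
  unfold uniformOutput
  infer_instance

open Classical in
/-- The output law for given noisy ranks. -/
noncomputable def outputGiven {m : ℕ} (b ε₂ ℓ : ℝ) (π : Equiv.Perm (Fin m)) (X : Dataset)
    (v : Fin m → ℤ) : Measure (Fin m → ℝ) :=
  if v ∈ Good m X.card (halfWidth ℓ) then loop b (halfWidth ℓ) ε₂ π X v m else uniformOutput m b

theorem outputGiven_apply_le_one {m : ℕ} {b : ℝ} (hb : 0 < b) (ε₂ ℓ : ℝ) (π : Equiv.Perm (Fin m))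
    (X : Dataset) (v : Fin m → ℤ) (S : Set (Fin m → ℝ)) : outputGiven b ε₂ ℓ π X v S ≤ 1 := by
  refine (measure_mono (subset_univ S)).trans ?_
  unfold outputGiven
  split_ifs
  · exact loop_univ_le_one le_rfl
  · have := isProbabilityMeasure_uniformOutput m hb
    exact prob_le_one

theorem mechanism_apply {m : ℕ} (b ε₁ ε₂ ℓ : ℝ) (π : Equiv.Perm (Fin m)) (r : Fin m → ℤ)
    (X : Dataset) {S : Set (Fin m → ℝ)} (hS : MeasurableSet S) :
    mechanism b ε₁ ε₂ ℓ 0 π r X S =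
      ∫⁻ v, outputGiven b ε₂ ℓ π X v S ∂continualCounting m ε₁ r := by
  rw [mechanism, Measure.bind_apply hS Measurable.of_discrete.aemeasurable]
  simp [outputGiven]

/-! ### Privacy -/

/-- If shifting the noisy ranks makes the output laws `exp ε₂`-close outside an event of
probability `δ`, then the mechanism satisfies the privacy inequality. -/
theorem mechanism_le_of_shift {m : ℕ} (hm : 1 ≤ m) {b ε₁ ε₂ δ ℓ : ℝ} (hb : 0 < b) (hε₁ : 0 < ε₁)
    {π : Equiv.Perm (Fin m)} {r : Fin m → ℤ} {X X' : Dataset} {E : Set (Fin m → ℤ)}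
    (hE : continualCounting m ε₁ r Eᶜ ≤ ENNReal.ofReal δ) {t : ℕ} (ht : t ≤ m) {σ : ℤ}
    (hσ : |σ| ≤ 1)
    (H : ∀ v ∈ E, outputGiven b ε₂ ℓ π X v ≤ ENNReal.ofReal (Real.exp ε₂) •
      outputGiven b ε₂ ℓ π X' (fun j => v j + if t ≤ j.val then σ else 0))
    {S : Set (Fin m → ℝ)} (hS : MeasurableSet S) :
    mechanism b ε₁ ε₂ ℓ 0 π r X S ≤
      ENNReal.ofReal (Real.exp (ε₁ + ε₂)) * mechanism b ε₁ ε₂ ℓ 0 π r X' S +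
        ENNReal.ofReal δ := by
  classical
  rw [mechanism_apply _ _ _ _ _ _ _ hS, mechanism_apply _ _ _ _ _ _ _ hS]
  set P := continualCounting m ε₁ r
  set e := ENNReal.ofReal (Real.exp ε₂)
  set f : (Fin m → ℤ) → ℝ≥0∞ := fun v =>
    outputGiven b ε₂ ℓ π X' (fun j => v j + if t ≤ j.val then σ else 0) S with hf
  -- The opposite shift of the noise cancels the shift inside `f`.
  have hf_le := lintegral_continualCounting_le hm hε₁ r ht (σ := -σ) (by rwa [abs_neg]) f
  have hfs : ∀ v : Fin m → ℤ, f (fun j => v j + if t ≤ j.val then -σ else 0) =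
      outputGiven b ε₂ ℓ π X' v S := by
    intro v
    simp only [hf]
    congr 2
    funext j
    split_ifs <;> simp
  simp only [hfs] at hf_le
  calc ∫⁻ v, outputGiven b ε₂ ℓ π X v S ∂P
      ≤ ∫⁻ v, (e * f v + Eᶜ.indicator 1 v) ∂P := by
        refine lintegral_mono fun v => ?_
        by_cases hv : v ∈ E
        · exact (H v hv S).trans (le_add_right le_rfl)
        · rw [indicator_of_mem (show v ∈ Eᶜ from hv)]
          exact (outputGiven_apply_le_one hb _ _ _ _ _ _).trans (le_add_left le_rfl)
    _ = e * ∫⁻ v, f v ∂P + P Eᶜ := by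
        rw [lintegral_add_left Measurable.of_discrete, lintegral_const_mul _ Measurable.of_discrete,
          lintegral_indicator_one MeasurableSet.of_discrete]
    _ ≤ e * (ENNReal.ofReal (Real.exp ε₁) * ∫⁻ v, outputGiven b ε₂ ℓ π X' v S ∂P) +
          ENNReal.ofReal δ := by gcongr
    _ = _ := by
        rw [add_comm ε₁, Real.exp_add, ENNReal.ofReal_mul (by positivity), mul_assoc]

theorem outputGiven_le_smul {m : ℕ} {b ε₂ ℓ : ℝ} {π : Equiv.Perm (Fin m)} {X X' : Dataset}
    {v v' : Fin m → ℤ} (hv : v ∈ Good m X.card (halfWidth ℓ))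
    (hv' : v' ∈ Good m X'.card (halfWidth ℓ)) (hε₂ : 0 ≤ ε₂) {B : Set (Fin m)}
    (hB : B.Subsingleton)
    (hout : ∀ j ∉ B, slice X b (halfWidth ℓ) (v j) = slice X' b (halfWidth ℓ) (v' j))
    (hin : ∀ j ∈ B, ∀ z, |(rank (slice X b (halfWidth ℓ) (v j)) z : ℝ) -
      rank (slice X' b (halfWidth ℓ) (v' j)) z| ≤ 1) :
    outputGiven b ε₂ ℓ π X v ≤ ENNReal.ofReal (Real.exp ε₂) • outputGiven b ε₂ ℓ π X' v' := by
  rw [outputGiven, outputGiven, if_pos hv, if_pos hv']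
  exact loop_le_smul hε₂ hB hout hin

theorem exists_threshold {m : ℕ} {A : Fin m → Prop} (hA : ∀ i j, i ≤ j → A i → A j) :
    ∃ t ≤ m, ∀ j : Fin m, t ≤ j.val ↔ A j := by
  classical
  have hex : ∃ k, ∀ h : k < m, A ⟨k, h⟩ := ⟨m, fun h => absurd h (lt_irrefl m)⟩
  refine ⟨Nat.find hex, Nat.find_min' hex fun h => absurd h (lt_irrefl m), fun j => ?_⟩
  constructor
  · intro h
    exact hA ⟨Nat.find hex, h.trans_lt j.isLt⟩ j h (Nat.find_spec hex _)
  · intro h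
    exact Nat.find_min' hex fun _ => h

/-- The privacy inequality in both directions for the insertion of one point. -/
theorem mechanism_cons_le {m : ℕ} (hm : 2 ≤ m) {b ε₁ ε₂ δ ℓ : ℝ} (hb : 0 < b) (hε₁ : 0 < ε₁)
    (hε₂ : 0 < ε₂) (hδ : 0 < δ) (hδ1 : δ < 1) (π : Equiv.Perm (Fin m)) {r : Fin m → ℤ}
    {X : Dataset} {x : ℝ} (hx : ∀ y ∈ x ::ₘ X, y ∈ Icc 0 b)
    (hr : Requirement (noiseBound m ε₁ δ) ℓ r X.card) {S : Set (Fin m → ℝ)}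
    (hS : MeasurableSet S) :
    mechanism b ε₁ ε₂ ℓ 0 π r X S ≤ ENNReal.ofReal (Real.exp (ε₁ + ε₂)) *
        mechanism b ε₁ ε₂ ℓ 0 π r (x ::ₘ X) S + ENNReal.ofReal δ ∧
      mechanism b ε₁ ε₂ ℓ 0 π r (x ::ₘ X) S ≤ ENNReal.ofReal (Real.exp (ε₁ + ε₂)) *
        mechanism b ε₁ ε₂ ℓ 0 π r X S + ENNReal.ofReal δ := by
  set w := noiseBound m ε₁ δ with hw
  set h := halfWidth ℓ with hh
  have hw0 : 0 ≤ w := noiseBound_nonneg (by omega) hε₁ hδ hδ1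
  have hH : 0 ≤ w + h + 1 := by positivity
  have hr' : r ∈ Good m X.card (w + h + 1) := hr
  obtain ⟨p, hp1, hp2⟩ := exists_insert_position X x b
  have hrmono : ∀ i j, i ≤ j → r i ≤ r j := by
    intro i j hij
    rcases hij.eq_or_lt with rfl | hlt
    · rfl
    · have := Good.add_le hr' hH hlt
      have : (r i : ℝ) ≤ r j := by linarith
      exact_mod_cast this
  -- The indices whose slices lie above `p` for all close noisy ranks. The condition involves only
  -- `r`, so one `t` serves every `v`.
  obtain ⟨t, ht, hA⟩ := exists_threshold
    (A := fun j : Fin m => (p : ℝ) < r j - (w + 1 / 2) - h) (by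
      intro i j hij hi
      have : (r i : ℝ) ≤ r j := by exact_mod_cast hrmono i j hij
      linarith)
  set B : Set (Fin m) := {j | ¬ t ≤ j.val ∧ (p : ℝ) ≤ r j + (w + 1 / 2) + h} with hBdef
  -- Two members would have ranks at most `2 (w + 1/2 + h)` apart, less than the required `2 (w + h
  -- + 1)`.
  have hB : B.Subsingleton := by
    have key : ∀ i ∈ B, ∀ j ∈ B, ¬ i < j := by
      intro i hi j hj hij
      have h1 := Good.add_le hr' hH hij
      have h2 := hi.2
      have h3 := hj.1
      rw [hA, not_lt] at h3
      linarith
    intro i hi j hj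
    rcases lt_trichotomy i j with hij | hij | hij
    · exact absurd hij (key i hi j hj)
    · exact hij
    · exact absurd hij (key j hj i hi)
  have hE := continualCounting_compl_closeRanks_le hm hε₁ hδ hδ1 r
  have habove : ∀ v ∈ closeRanks r w, ∀ j : Fin m, t ≤ j.val → p < v j - h := by
    intro v hv j hj
    have h1 := (hA j).1 hj
    have h2 := abs_le.1 (hv j)
    have : (p : ℝ) < v j - h := by linarith
    exact_mod_cast this
  have hbelow : ∀ v ∈ closeRanks r w, ∀ j : Fin m, ¬ t ≤ j.val → j ∉ B →
      slice X b h (v j) = slice (x ::ₘ X) b h (v j) := by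
    intro v hv j hj hjB
    have h1 : (r j : ℝ) + (w + 1 / 2) + h < p := by
      by_contra hc
      exact hjB ⟨hj, not_lt.1 hc⟩
    have h2 := abs_le.1 (hv j)
    have h3 : (v j : ℝ) + h < p := by linarith
    have h4 : v j + h < p := by exact_mod_cast h3
    exact slice_congr fun u hu => (hp1 _ (by omega)).symm
  have hnear : ∀ u z, |(rank (slice X b h u) z : ℝ) - rank (slice (x ::ₘ X) b h u) z| ≤ 1 :=
    fun u z => abs_rank_slice_sub_le h u (fun k => (orderStat_interlace hb.le hx k).1)
      (fun k => (orderStat_interlace hb.le hx k).2) z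
  have hcard : (Multiset.card (x ::ₘ X) : ℤ) - Multiset.card X = 1 := by
    rw [Multiset.card_cons]; push_cast; ring
  have hgood : ∀ v ∈ closeRanks r w, v ∈ Good m X.card h ∧ v ∈ Good m (x ::ₘ X).card h := by
    intro v hv
    constructor
    · simpa using add_mem_good (s := 0) (n' := X.card) hr' hv (by simp) (by simp) (by simp)
    · simpa using add_mem_good (s := 0) (n' := (x ::ₘ X).card) hr' hv (by simp)
        (by intro j; rw [hcard]; simp) (by simp)
  constructor
  · refine mechanism_le_of_shift (by omega) hb hε₁ hE ht (σ := 1) (by simp) (fun v hv => ?_) hS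
    refine outputGiven_le_smul (hgood v hv).1 ?_ hε₂.le hB (fun j hj => ?_) (fun j hj z => ?_)
    · refine add_mem_good hr' hv (fun j => ?_) (fun j => ?_) (fun i j => ?_)
      · split_ifs <;> omega
      · rw [hcard]; split_ifs <;> omega
      · split_ifs <;> omega
    · by_cases htj : t ≤ j.val
      · rw [if_pos htj]
        have := habove v hv j htj
        refine slice_congr fun u hu => ?_
        rw [hp2 _ (by omega)]
        congr 1
        ring
      · rw [if_neg htj, add_zero]
        exact hbelow v hv j htj hj
    · rw [if_neg hj.1, add_zero]
      exact hnear _ z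
  · refine mechanism_le_of_shift (by omega) hb hε₁ hE ht (σ := -1) (by simp) (fun v hv => ?_) hS
    refine outputGiven_le_smul (hgood v hv).2 ?_ hε₂.le hB (fun j hj => ?_) (fun j hj z => ?_)
    · refine add_mem_good hr' hv (fun j => ?_) (fun j => ?_) (fun i j => ?_)
      · split_ifs <;> omega
      · split_ifs <;> omega
      · split_ifs <;> omega
    · by_cases htj : t ≤ j.val
      · rw [if_pos htj]
        have := habove v hv j htj
        refine slice_congr fun u hu => ?_
        rw [hp2 _ (by omega)]
        congr 1
        ring
      · rw [if_neg htj, add_zero]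
        exact (hbelow v hv j htj hj).symm
    · rw [if_neg hj.1, add_zero, abs_sub_comm]
      exact hnear _ z

theorem isDP_mechanism {m : ℕ} {b ε₁ ε₂ δ ℓ : ℝ} (π : Equiv.Perm (Fin m)) (r : Fin m → ℤ)
    (hm : 2 ≤ m) (hb : 0 < b) (hε₁ : 0 < ε₁) (hε₂ : 0 < ε₂) (hδ : 0 < δ) :
    IsDP (inputs b (noiseBound m ε₁ δ) ℓ r) (mechanism b ε₁ ε₂ ℓ 0 π r) (ε₁ + 2 * ε₂) δ := by
  intro X hX X' hX' hadj S hS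
  -- For `δ ≥ 1` the claim is trivial because the output mass is at most one; the tail bound needs
  -- `δ < 1`.
  rcases le_or_gt 1 δ with hδ1 | hδ1
  · refine le_add_left (le_trans ?_ (ENNReal.one_le_ofReal.2 hδ1))
    rw [mechanism_apply _ _ _ _ _ _ _ hS]
    have := isProbabilityMeasure_continualCounting (m := m) (by omega) hε₁ r
    refine (lintegral_mono fun v => outputGiven_apply_le_one hb ε₂ ℓ π X v S).trans ?_
    simp
  have hexp : ENNReal.ofReal (Real.exp (ε₁ + ε₂)) ≤ ENNReal.ofReal (Real.exp (ε₁ + 2 * ε₂)) :=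
    ENNReal.ofReal_le_ofReal (Real.exp_le_exp.2 (by linarith))
  obtain ⟨x, rfl | rfl⟩ := hadj
  · refine (mechanism_cons_le hm hb hε₁ hε₂ hδ hδ1 π hX'.1 hX.2 hS).1.trans ?_
    gcongr
  · refine (mechanism_cons_le hm hb hε₁ hε₂ hδ hδ1 π hX.1 hX'.2 hS).2.trans ?_
    gcongr

/-! ### Rank error -/

/-- The slice half-width contributes `2 / c`, the noise `6 / c`, and the roundings `3/2 ≤ 3`. Both
`log m` and `log (m / β)` are at least one, so lower-order terms fit into their product. -/
theorem errorBound_le {m : ℕ} {c b ε ε₁ ε₂ β ℓ : ℝ} (hc : 0 < c) (hm : 2 ≤ m) (hb : 1 < b)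
    (hε₁ : 0 < ε₁) (hε₂ : 0 < ε₂) (hε : ε = ε₁ + 2 * ε₂) (h1 : c * ε ≤ ε₁) (h2 : c * ε ≤ ε₂)
    (hβ0 : 0 < β) (hβ : β < 1) (hℓ : ℓ = 4 * Real.logb 2 (b * m / β) / ε₂) :
    halfWidth ℓ + noiseBound m ε₁ β + 1 / 2 ≤ (8 / c + 3) *
      (Real.logb 2 b / ε + Real.logb 2 m * Real.logb 2 (m / β) / ε + 1) := by
  have hm' : (2 : ℝ) ≤ m := by exact_mod_cast hm
  have hε0 : 0 < ε := by linarith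
  have hcε : 0 < c * ε := by positivity
  have hmβ : 2 ≤ m / β := by
    rw [le_div_iff₀ hβ0]; linarith
  have hLm : 1 ≤ Real.logb 2 (m : ℝ) := by
    rw [Real.le_logb_iff_rpow_le one_lt_two (by linarith)]
    simpa using hm'
  have hLβ : 1 ≤ Real.logb 2 (m / β) := by
    rw [Real.le_logb_iff_rpow_le one_lt_two (by linarith)]
    simpa using hmβ
  have hLb : 0 ≤ Real.logb 2 b := Real.logb_nonneg one_lt_two hb.le
  have e1 : Real.logb 2 (b * m / β) = Real.logb 2 b + Real.logb 2 (m / β) := by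
    rw [mul_div_assoc, Real.logb_mul (by linarith) (by linarith)]
  have e2 : Real.logb 2 (2 * m / β) = 1 + Real.logb 2 (m / β) := by
    rw [mul_div_assoc, Real.logb_mul (by norm_num) (by linarith),
      Real.logb_self_eq_one one_lt_two]
  have hℓ0 : 0 ≤ ℓ := by rw [hℓ, e1]; positivity
  have hceil : (halfWidth ℓ : ℝ) < ℓ / 2 + 1 := Nat.ceil_lt_add_one (by positivity)
  set p := Real.logb 2 b
  set q := Real.logb 2 (m : ℝ)
  set u := Real.logb 2 (m / β)
  have hqu : u ≤ q * u := by nlinarith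
  have b1 : ℓ / 2 ≤ 2 * (p + q * u) / (c * ε) := by
    rw [hℓ, e1]
    calc 4 * (p + u) / ε₂ / 2 = 2 * (p + u) / ε₂ := by ring
      _ ≤ 2 * (p + q * u) / (c * ε) := by gcongr
  have b2 : noiseBound m ε₁ β ≤ 6 * (q * u) / (c * ε) := by
    rw [noiseBound, e2]
    have : 3 * q * (1 + u) ≤ 6 * (q * u) := by nlinarith
    gcongr
  have b3 : 2 * (p + q * u) / (c * ε) + 6 * (q * u) / (c * ε) ≤
      8 / c * (p / ε + q * u / ε) := by
    rw [← add_div, ← add_div, div_mul_div_comm]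
    gcongr
    nlinarith
  have b4 : 0 ≤ p / ε + q * u / ε := by positivity
  have b5 : 0 < 8 / c := by positivity
  nlinarith

theorem le_mechanism_rankError {m : ℕ} {c b ε ε₁ ε₂ δ β ℓ : ℝ} {π : Equiv.Perm (Fin m)}
    {X : Dataset} {q : Fin m → ℝ} (hc : 0 < c) (hm : 2 ≤ m) (hb : 1 < b)
    (hε₁ : 0 < ε₁) (hε₂ : 0 < ε₂) (hε : ε = ε₁ + 2 * ε₂) (h1 : c * ε ≤ ε₁) (h2 : c * ε ≤ ε₂)
    (hδ : 0 < δ) (hδβ : δ ≤ β) (hβ : β < 1) (hℓ : ℓ = 4 * Real.logb 2 (b * m / β) / ε₂)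
    (hX : ∀ x ∈ X, x ∈ Ioo (0 : ℝ) b) (hgap : HasUnitGap X)
    (hreq : Requirement (noiseBound m ε₁ δ) ℓ (targetRank q X.card) X.card) :
    ENNReal.ofReal (1 - 3 * β) ≤ mechanism b ε₁ ε₂ ℓ 0 π (targetRank q X.card) X
      {z | rankError X q z ≤ (8 / c + 3) *
        (Real.logb 2 b / ε + Real.logb 2 m * Real.logb 2 (m / β) / ε + 1)} := by
  have hβ0 : 0 < β := hδ.trans_le hδβ
  have hb0 : 0 < b := one_pos.trans hb
  have hm' : (2 : ℝ) ≤ m := by exact_mod_cast hm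
  have hmβ : 1 < b * m / β := by
    rw [lt_div_iff₀ hβ0]; nlinarith
  have hX' : ∀ x ∈ X, x ∈ Icc (0 : ℝ) b := fun x hx => Ioo_subset_Icc_self (hX x hx)
  set r := targetRank q X.card with hr_def
  set h := halfWidth ℓ with hh
  set w := noiseBound m ε₁ β with hw
  have hwδ : w ≤ noiseBound m ε₁ δ := by
    have hq : 0 ≤ Real.logb 2 (m : ℝ) := Real.logb_nonneg one_lt_two (by linarith)
    have : Real.logb 2 (2 * m / β) ≤ Real.logb 2 (2 * m / δ) := by
      refine Real.logb_le_logb_of_le one_lt_two (by positivity) ?_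
      gcongr
    rw [hw, noiseBound, noiseBound]
    gcongr
  have hw0 : 0 ≤ w := noiseBound_nonneg (by omega) hε₁ hβ0 hβ
  have hlog : 0 < Real.logb 2 (b * m / β) := Real.logb_pos one_lt_two hmβ
  have hh1 : 1 ≤ h := Nat.ceil_pos.2 (by rw [hℓ]; positivity)
  have hhℓ : ℓ / 2 ≤ h := Nat.le_ceil _
  have hreq' : r ∈ Good m X.card (noiseBound m ε₁ δ + h + 1) := hreq
  have hH : 0 ≤ noiseBound m ε₁ δ + h + 1 := by linarith [Nat.cast_nonneg (α := ℝ) h]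
  set D := (8 / c + 3) *
    (Real.logb 2 b / ε + Real.logb 2 m * Real.logb 2 (m / β) / ε + 1) with hD
  have hbound : h + w + 1 / 2 ≤ D := errorBound_le hc hm hb hε₁ hε₂ hε h1 h2 hβ0 hβ hℓ
  set G : Set (Fin m → ℝ) := {z | ∀ i, |(rank X (z i) : ℝ) - r i| ≤ D} with hG
  have hGmeas : MeasurableSet G := by
    have : G = ⋂ i, {z | |(rank X (z i) : ℝ) - r i| ≤ D} := by ext z; simp [hG]
    rw [this]
    refine MeasurableSet.iInter fun i => ?_
    have hrank : Measurable fun z : Fin m → ℝ => (rank X (z i) : ℝ) :=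
      measurable_from_nat.comp ((measurable_rank X).comp (measurable_pi_apply i))
    exact measurableSet_le (by fun_prop) measurable_const
  have hGsub : G ⊆ {z | rankError X q z ≤ D} := by
    intro z hz
    have : Nonempty (Fin m) := ⟨⟨0, by omega⟩⟩
    exact ciSup_le hz
  -- The factor `4` in `ℓ` gives `ε₂ h / 2 ≥ log (bm/β)` to base `2`, which dominates the natural
  -- logarithm.
  have hη : b * Real.exp (-(ε₂ * h / 2)) ≤ β / m := by
    have h3 : Real.logb 2 (b * m / β) ≤ ε₂ * h / 2 := by
      calc Real.logb 2 (b * m / β) = ε₂ * (ℓ / 2) / 2 := by rw [hℓ]; field_simp; norm_num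
        _ ≤ ε₂ * h / 2 := by gcongr
    have h4 : Real.log (b * m / β) ≤ Real.logb 2 (b * m / β) := by
      have : Real.log 2 ≤ 1 := by
        have := Real.log_le_sub_one_of_pos two_pos
        linarith
      rw [Real.logb, le_div_iff₀ (Real.log_pos one_lt_two)]
      exact mul_le_of_le_one_right (Real.log_pos hmβ).le this
    calc b * Real.exp (-(ε₂ * h / 2)) ≤ b * Real.exp (-Real.log (b * m / β)) := by
          gcongr; linarith
      _ = β / m := by
          rw [Real.exp_neg, Real.exp_log (by linarith), inv_div]
          field_simp
  have hloop : ∀ v ∈ closeRanks r w, ENNReal.ofReal (1 - β) ≤ outputGiven b ε₂ ℓ π X v G := by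
    intro v hv
    have hvδ : v ∈ closeRanks r (noiseBound m ε₁ δ) := fun j => (hv j).trans (by linarith)
    have hgood : v ∈ Good m X.card h := by
      simpa using add_mem_good (s := 0) (n' := X.card) hreq' hvδ (by simp) (by simp) (by simp)
    -- With `hup`, this keeps both ends of each slice among the actual data points, where order
    -- statistics determine ranks.
    have hlow : ∀ j, (h : ℤ) + 1 ≤ v j := by
      intro j
      have h3 := Good.le_apply hreq' hH j
      have h4 := abs_le.1 (hvδ j)
      have h5 : ((h : ℤ) : ℝ) < v j := by push_cast; linarith
      have h6 : (h : ℤ) < v j := by exact_mod_cast h5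
      omega
    have hup : ∀ j, v j + h ≤ X.card := by
      intro j
      have h3 := Good.apply_le hreq' hH j
      have h4 := abs_le.1 (hvδ j)
      have h5 : (v j : ℝ) + h ≤ X.card := by linarith
      exact_mod_cast h5
    have hsep : ∀ i j, i < j → v i + 2 * h ≤ v j := by
      intro i j hij
      have := Good.add_le hgood (Nat.cast_nonneg h) hij
      exact_mod_cast this
    rw [outputGiven, if_pos hgood]
    have hβm : β / m ≤ 1 := by
      rw [div_le_one (by linarith)]; linarith
    have h3 := le_loop_inSlices (π := π) hb0.le hX' hgap hh1 hε₂.le hlow hup hsep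
      (show 0 ≤ β / m by positivity) hβm hη le_rfl
    refine le_trans (ENNReal.ofReal_le_ofReal ?_) (h3.trans (measure_mono fun z hz i => ?_))
    -- Bernoulli's inequality: `(1 - β / m) ^ m ≥ 1 - β`.
    · have := one_add_mul_le_pow (a := -(β / m)) (by linarith) m
      rw [mul_neg, mul_div_cancel₀ _ (by linarith), ← sub_eq_add_neg, ← sub_eq_add_neg] at this
      exact this
    · obtain ⟨hz1, hz2⟩ := hz i (π.symm i).isLt
      have h4 := hlow i
      have h5 := hup i
      have h6 := le_rank_of_orderStat_lt (by omega) (by omega) hz1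
      have h7 := rank_lt_of_le_orderStat (by omega) (by omega) hz2
      have h6' : (v i : ℝ) - h ≤ rank X (z i) := by exact_mod_cast h6
      have h7' : (rank X (z i) : ℝ) < v i + h := by exact_mod_cast h7
      have h8 := abs_le.1 (hv i)
      rw [abs_le]
      constructor <;> linarith
  have hP := isProbabilityMeasure_continualCounting (m := m) (by omega) hε₁ r
  have hE := continualCounting_compl_closeRanks_le hm hε₁ hβ0 hβ r
  have hE' : ENNReal.ofReal (1 - β) ≤ continualCounting m ε₁ r (closeRanks r w) := by
    rw [ENNReal.ofReal_sub _ hβ0.le, ENNReal.ofReal_one, tsub_le_iff_right,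
      ← prob_add_prob_compl (μ := continualCounting m ε₁ r) (s := closeRanks r w)
        MeasurableSet.of_discrete]
    gcongr
  refine le_trans ?_ (measure_mono hGsub)
  rw [mechanism_apply _ _ _ _ _ _ _ hGmeas]
  calc ENNReal.ofReal (1 - 3 * β) ≤ ENNReal.ofReal (1 - β) * ENNReal.ofReal (1 - β) := by
        rw [← ENNReal.ofReal_mul (by linarith)]
        exact ENNReal.ofReal_le_ofReal (by nlinarith)
    _ ≤ ENNReal.ofReal (1 - β) * continualCounting m ε₁ r (closeRanks r w) :=
        mul_le_mul_right hE' _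
    _ = ∫⁻ _ in closeRanks r w, ENNReal.ofReal (1 - β) ∂continualCounting m ε₁ r := by
        rw [setLIntegral_const]
    _ ≤ ∫⁻ v in closeRanks r w, outputGiven b ε₂ ℓ π X v G ∂continualCounting m ε₁ r :=
        setLIntegral_mono' MeasurableSet.of_discrete hloop
    _ ≤ _ := setLIntegral_le_lintegral _ _

end SliceQuantiles

open SliceQuantiles in
theorem corollary3 :
    -- privacy, for every slice parameter
    (∀ (m : ℕ) (b ε₁ ε₂ δ ℓ : ℝ) (π : Equiv.Perm (Fin m)) (r : Fin m → ℤ),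
      2 ≤ m → 0 < b → 0 < ε₁ → 0 < ε₂ → 0 < δ → 0 < ℓ →
      IsDP (inputs b (noiseBound m ε₁ δ) ℓ r) (mechanism b ε₁ ε₂ ℓ 0 π r) (ε₁ + 2 * ε₂) δ) ∧
    -- rank error, with a constant that depends only on the share of each budget in `ε`
    (∀ c : ℝ, 0 < c → ∃ C : ℝ, ∀ (m : ℕ) (b ε ε₁ ε₂ δ β ℓ : ℝ) (π : Equiv.Perm (Fin m))
      (X : Dataset) (q : Fin m → ℝ),
      2 ≤ m → 1 < b → 0 < ε₁ → 0 < ε₂ → ε = ε₁ + 2 * ε₂ → c * ε ≤ ε₁ → c * ε ≤ ε₂ →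
      0 < δ → δ ≤ β → β < 1 → ℓ = 4 * Real.logb 2 (b * m / β) / ε₂ →
      (∀ x ∈ X, x ∈ Set.Ioo (0 : ℝ) b) → HasUnitGap X → IsQuantiles q →
      Requirement (noiseBound m ε₁ δ) ℓ (targetRank q X.card) X.card →
      ENNReal.ofReal (1 - 3 * β) ≤
        mechanism b ε₁ ε₂ ℓ 0 π (targetRank q X.card) X
          {z | rankError X q z ≤
            C * (Real.logb 2 b / ε + Real.logb 2 m * Real.logb 2 (m / β) / ε + 1)}) ∧
    -- the gap condition on the quantiles suffices for the input requirement
    (∀ (m n : ℕ) (b ε₁ ε₂ δ β ℓ : ℝ) (q : Fin m → ℝ),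
      2 ≤ m → 1 ≤ n → 1 < b → 0 < ε₁ → 0 < ε₂ → 0 < δ → δ ≤ β → β < 1 →
      ℓ = 4 * Real.logb 2 (b * m / β) / ε₂ → IsQuantiles q →
      HasQuantileGap q (minGap m n b ε₁ ε₂ δ β + 3 / n) →
      Requirement (noiseBound m ε₁ δ) ℓ (targetRank q n) n) := by
  refine ⟨fun m b ε₁ ε₂ δ ℓ π r hm hb hε₁ hε₂ hδ _ => isDP_mechanism π r hm hb hε₁ hε₂ hδ,
    fun c hc => ⟨8 / c + 3, ?_⟩, ?_⟩
  · intro m b ε ε₁ ε₂ δ β ℓ π X q hm hb hε₁ hε₂ hε h1 h2 hδ hδβ hβ hℓ hX hgap _ hreq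
    exact le_mechanism_rankError hc hm hb hε₁ hε₂ hε h1 h2 hδ hδβ hβ hℓ hX hgap hreq
  · intro m n b ε₁ ε₂ δ β ℓ q hm hn hb hε₁ hε₂ hδ hδβ hβ hℓ _ hq
    exact requirement_of_hasQuantileGap hm hn hb hε₁ hε₂ (hδ.trans_le hδβ) hβ hℓ hq
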